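/- **Proposition 3.1 (Yu Chen).** Let $(W,S)$ be the Coxeter system of type $\mathsf{E}_8$ (the Weyl group of type $\mathsf{E}_8$ with its simple reflections), where $S=\{s_1,\dots,s_8\}$ is numbered as in Bourbaki: $s_1,s_3,s_4,s_5,s_6,s_7,s_8$ are the successive nodes of a subdiagram of type $\mathsf{A}_7$, and $s_2$ is joined to $s_4$ only. Let $\ell$ be the length function, let $\mathcal L(w)=\{s\in S:\ \ell(sw)<\ell(w)\}$, and let $P_{x,y}\in\mathbb Z[q]$ $(x,y\in W)$ be the Kazhdan–Lusztig polynomials of $(W,S)$, with $P_{x,y}=0$ unless $x\le y$ in the Bruhat order. For $x,y\in W$ write $x - y$ if $\ell(y)-\ell(x)$ is odd and either $P_{x,y}$ or $P_{y,x}$ is a nonzero polynomial of the maximal possible degree $(|\ell(y)-\ell(x)|-1)/2$. Write $x\leqslant_L y$ if there is a sequence $x=x_0,x_1,\dots,x_n=y$ in $W$, $n\ge 0$, such that $x_{i-1} - x_i$ and $\mathcal L(x_{i-1})\not\subseteq\mathcal L(x_i)$ for all $1\le i\le n$, and write $x\sim_L y$ if $x\leqslant_L y$ and $y\leqslant_L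 x$; the classes of $\sim_L$ are the left Kazhdan–Lusztig cells of $W$. Put $$w_1=(s_2s_3s_5s_4)^2s_7,\qquad w_2=s_1s_3s_1s_2s_5s_6s_5s_8 .$$ Then $w_1w_2\sim_L w_2$, that is, $w_1w_2$ and $w_2$ lie in the same left Kazhdan–Lusztig cell of $W$. -/

import Mathlib

open Polynomial

namespace KazhdanLusztig

/-- The ring `ℤ[v, v⁻¹]` of Laurent polynomials, where `v = q ^ (1/2)`. -/
abbrev Coeff : Type := LaurentPolynomial ℤ

/-- The power `v ^ n` of the indeterminate `v = q ^ (1/2)`. -/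
noncomputable def vpow (n : ℤ) : Coeff := LaurentPolynomial.T n

/-- The element `q = v ^ 2`. -/
noncomputable def q : Coeff := vpow 2

/-- The element `q⁻¹ = v ^ (-2)`. -/
noncomputable def qInv : Coeff := vpow (-2)

variable {B W : Type*} [Group W] {M : CoxeterMatrix B}

/-- The defining relations of the Iwahori-Hecke algebra, on generators `T_w` for `w` in `W`:
`T_1 = 1`, `T_x T_y = T_{xy}` if the lengths of `x` and `y` add up, and
`(T_s + 1) (T_s - q) = 0` for the simple reflections `s`. -/
inductive HeckeRel (cs : CoxeterSystem M W) : FreeAlgebra Coeff W → FreeAlgebra Coeff W → Prop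
  | one : HeckeRel cs (FreeAlgebra.ι Coeff 1) 1
  | mul (x y : W) (h : cs.length (x * y) = cs.length x + cs.length y) :
      HeckeRel cs (FreeAlgebra.ι Coeff x * FreeAlgebra.ι Coeff y) (FreeAlgebra.ι Coeff (x * y))
  | quadratic (i : B) :
      HeckeRel cs
        ((FreeAlgebra.ι Coeff (cs.simple i) + 1) *
          (FreeAlgebra.ι Coeff (cs.simple i) - algebraMap Coeff (FreeAlgebra Coeff W) q)) 0

/-- The (one-parameter, generic) Iwahori-Hecke algebra of a Coxeter system over `ℤ[v, v⁻¹]`. -/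
def HeckeAlgebra (cs : CoxeterSystem M W) : Type _ := RingQuot (HeckeRel cs)

noncomputable instance (cs : CoxeterSystem M W) : Ring (HeckeAlgebra cs) :=
  inferInstanceAs (Ring (RingQuot (HeckeRel cs)))

noncomputable instance (cs : CoxeterSystem M W) : Algebra Coeff (HeckeAlgebra cs) :=
  inferInstanceAs (Algebra Coeff (RingQuot (HeckeRel cs)))

/-- The canonical surjection from the free algebra on the symbols `T_w` to the Hecke algebra. -/
noncomputable def heckeMk (cs : CoxeterSystem M W) :
    FreeAlgebra Coeff W →ₐ[Coeff] HeckeAlgebra cs :=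
  RingQuot.mkAlgHom Coeff (HeckeRel cs)

/-- The standard basis element `T_w` of the Hecke algebra. -/
noncomputable def heckeT (cs : CoxeterSystem M W) (w : W) : HeckeAlgebra cs :=
  heckeMk cs (FreeAlgebra.ι Coeff w)

/-- The Bruhat order: `x ≤ y` if `y` is obtained from `x` by successive multiplications by
reflections, each of which increases the length. -/
def BruhatLE (cs : CoxeterSystem M W) : W → W → Prop :=
  Relation.ReflTransGen fun x y =>
    ∃ t : W, cs.IsReflection t ∧ y = x * t ∧ cs.length x < cs.length y

/-- `IsKLFamily cs w p` says that `p x = P_{x,w}` for all `x`, i.e. that `p` is the family of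
Kazhdan-Lusztig polynomials with second index `w`. The last field expresses that the element
`C'_w = v ^ (-ℓ(w)) * ∑ x, P_{x,w}(q) T_x` is fixed by the bar involution of the Hecke algebra,
which sends `v` to `v⁻¹` and `T_x` to the inverse of `T_{x⁻¹}`. -/
structure IsKLFamily (cs : CoxeterSystem M W) (w : W) (p : W →₀ ℤ[X]) : Prop where
  apply_self : p w = 1
  support_le : ∀ x, p x ≠ 0 → BruhatLE cs x w
  /-- The bound `deg P_{x,w} ≤ (ℓ(w) - ℓ(x) - 1) / 2` for `x < w`. -/
  degree_le : ∀ x, BruhatLE cs x w → x ≠ w → 2 * (p x).natDegree + 1 + cs.length x ≤ cs.length w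
  bar_invariant :
    (p.sum fun x f => (vpow (cs.length w) * aeval qInv f) • Ring.inverse (heckeT cs x⁻¹)) =
      p.sum fun x f => (vpow (-(cs.length w : ℤ)) * aeval q f) • heckeT cs x

/-- The Kazhdan-Lusztig polynomial `P_{x,w}` (zero unless `x ≤ w` in the Bruhat order). -/
noncomputable def klPoly (cs : CoxeterSystem M W) (x w : W) : ℤ[X] :=
  Classical.epsilon (IsKLFamily cs w) x

/-- `deg P_{x,y}` is equal to its upper bound `(ℓ(y) - ℓ(x) - 1) / 2`; in particular `P_{x,y}` is
nonzero, so that `x < y` in the Bruhat order, and `ℓ(y) - ℓ(x)` is odd. -/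
def KLPrec (cs : CoxeterSystem M W) (x y : W) : Prop :=
  ∃ d : ℕ, cs.length y = cs.length x + 2 * d + 1 ∧ (klPoly cs x y).degree = d

/-- The symmetric relation `x - y`: one of `P_{x,y}`, `P_{y,x}` has the maximal possible degree. -/
def KLJoined (cs : CoxeterSystem M W) (x y : W) : Prop :=
  KLPrec cs x y ∨ KLPrec cs y x

/-- The left descent set `𝓛(w)`, as a set of indices of simple reflections. -/
def leftDescentSet (cs : CoxeterSystem M W) (w : W) : Set B :=
  {i | cs.IsLeftDescent w i}

/-- The left preorder: `x ≤_L y` if there are `x = x_0, x_1, …, x_n = y` such that `x_{k-1} - x_k`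
and `𝓛(x_{k-1})` is not contained in `𝓛(x_k)`, for `1 ≤ k ≤ n`. -/
def LeftLE (cs : CoxeterSystem M W) : W → W → Prop :=
  Relation.ReflTransGen fun x y =>
    KLJoined cs x y ∧ ¬ leftDescentSet cs x ⊆ leftDescentSet cs y

/-- The equivalence relation `x ∼_L y` whose classes are the left Kazhdan-Lusztig cells. -/
def LeftCellEquiv (cs : CoxeterSystem M W) (x y : W) : Prop :=
  LeftLE cs x y ∧ LeftLE cs y x

end KazhdanLusztig

/-! Write `w` for `w₂`. It is the longest element, of length 8, of the parabolic subgroup `W_J`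
generated by all simple reflections except `s₄` and `s₇`. Since `P_{x,sx} = 1` whenever `sx > x`,
the elements `x` and `sx` are always joined, so multiplication by `s` on the left is a step of `≤_L`
as soon as some left descent is lost.

The direction `w₁w ≤_L w` is easy: cancelling the letters of `w₁` one at a time loses the cancelled
letter as a descent (`leftLE_stabWord_right`). The converse needs two genuine Kazhdan–Lusztig edges,
both losing the descent `s₁` (`leftLE_stabWord_left`): `w → s₂s₃s₆s₅s₄w`, where `P = 1 + 2q + q²`
and the lengths are 8 and 13; and `s₄s₂s₅s₄w → s₂s₄s₅s₄s₂s₃s₄w`, where `P = 1 + q` and the lengths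
are 12 and 15. Multiplications by `s₃, s₄, s₆` and then by `s₇, s₃` fill the gaps.

The two polynomials come from the left ideal generated by `C'_w`. Its elements have coefficients
that are constant on the cosets `zW_J`, which correspond to the orbit of the weight `λ = ω₄ + ω₇`,
with stabilizer `W_J`. Such an element is a finite list of pairs (weight, exponent), and
multiplication by `T_s + 1` is explicit on lists (`listPoly_stepList`). Subtracting lower terms
gives a bar invariant list; once it meets the degree bound, uniqueness identifies it with the
Kazhdan–Lusztig polynomials (`IsBarInvariantList.klPoly_eq`).

This rests on general theory for simply laced Coxeter groups: positivity of roots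
(`rootRep_nonneg`), strong exchange and lifting for the Bruhat order, the regular representation,
which makes the `T_w` linearly independent, and existence and uniqueness of the polynomials
(`exists_isKLFamily`, `IsKLFamily.unique`). Descents and equalities in `W` are read off from the
orbit of the regular weight `ρ`. -/

namespace KazhdanLusztig

/-! ### The root lattice: signs of roots and right descents -/

section RootRepresentation

variable {B W : Type*} [DecidableEq B] [Group W] {M : CoxeterMatrix B}

/-- A Coxeter matrix is simply laced if its off-diagonal entries are all `2` or `3`. -/
class SimplyLaced {B : Type*} (M : CoxeterMatrix B) : Prop where
  eq_two_or_three : ∀ i j, i ≠ j → M i j = 2 ∨ M i j = 3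

/-- The Cartan matrix of a simply laced Coxeter matrix. -/
def cartan (M : CoxeterMatrix B) (i j : B) : ℤ :=
  if i = j then 2 else if M i j = 3 then -1 else 0

lemma cartan_self (i : B) : cartan M i i = 2 := by simp [cartan]

lemma cartan_comm (i j : B) : cartan M i j = cartan M j i := by
  simp only [cartan, M.symmetric i j, eq_comm]

variable [Fintype B]

/-- The pairing of a vector with the simple coroot `i`. -/
def coroot (M : CoxeterMatrix B) (i : B) : (B → ℤ) →ₗ[ℤ] ℤ :=
  ∑ j, cartan M i j • LinearMap.proj j

lemma coroot_apply (i : B) (c : B → ℤ) : coroot M i c = ∑ j, cartan M i j * c j := by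
  simp [coroot]

lemma coroot_single (i j : B) : coroot M i (Pi.single j 1) = cartan M i j := by
  simp [coroot_apply, Pi.single_apply]

/-- The simple reflection `i` of the root lattice. -/
def simpleRefl (M : CoxeterMatrix B) (i : B) : Module.End ℤ (B → ℤ) :=
  LinearMap.id - (coroot M i).smulRight (Pi.single i 1)

lemma simpleRefl_apply (i : B) (c : B → ℤ) :
    simpleRefl M i c = c - coroot M i c • Pi.single i 1 := by
  simp [simpleRefl]

lemma simpleRefl_single (i j : B) :
    simpleRefl M i (Pi.single j 1) = Pi.single j 1 - cartan M i j • Pi.single i 1 := by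
  rw [simpleRefl_apply, coroot_single]

lemma simpleRefl_single_self (i : B) :
    simpleRefl M i (Pi.single i 1) = - Pi.single i 1 := by
  rw [simpleRefl_single, cartan_self]; module

lemma simpleRefl_mul_self (i : B) : simpleRefl M i * simpleRefl M i = 1 := by
  refine LinearMap.ext fun c => ?_
  simp only [Module.End.mul_apply, simpleRefl_apply, map_sub, map_smul, coroot_single, cartan_self,
    Module.End.one_apply]
  module

lemma simpleRefl_isLiftable [SimplyLaced M] : M.IsLiftable (simpleRefl M) := by
  intro i j
  by_cases hij : i = j
  · subst hij
    rw [M.diagonal, simpleRefl_mul_self, one_pow]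
  · refine LinearMap.ext fun c => ?_
    rcases SimplyLaced.eq_two_or_three (M := M) i j hij with h | h
    · have h1 : cartan M i j = 0 := by simp [cartan, hij, h]
      have h2 : cartan M j i = 0 := by rw [cartan_comm, h1]
      rw [h]
      simp only [pow_succ, pow_zero, one_mul, Module.End.mul_apply, simpleRefl_apply, map_sub,
        map_smul, coroot_single, cartan_self, Module.End.one_apply, h1, h2]
      module
    · have h1 : cartan M i j = -1 := by simp [cartan, hij, h]
      have h2 : cartan M j i = -1 := by rw [cartan_comm, h1]
      rw [h]
      simp only [pow_succ, pow_zero, one_mul, Module.End.mul_apply, simpleRefl_apply, map_sub,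
        map_smul, coroot_single, cartan_self, Module.End.one_apply, h1, h2]
      module

/-- The symmetric bilinear form of the root lattice, evaluated on two vectors. -/
def rootForm (M : CoxeterMatrix B) (c d : B → ℤ) : ℤ := ∑ i, c i * coroot M i d

lemma rootForm_single_left (i : B) (d : B → ℤ) : rootForm M (Pi.single i 1) d = coroot M i d := by
  simp [rootForm, Pi.single_apply]

lemma rootForm_sub_left (c c' d : B → ℤ) :
    rootForm M (c - c') d = rootForm M c d - rootForm M c' d := by
  simp [rootForm, sub_mul, Finset.sum_sub_distrib]

lemma rootForm_smul_left (a : ℤ) (c d : B → ℤ) :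
    rootForm M (a • c) d = a * rootForm M c d := by
  simp [rootForm, Finset.mul_sum, mul_assoc]

lemma rootForm_comm (c d : B → ℤ) : rootForm M c d = rootForm M d c := by
  simp only [rootForm, coroot_apply, Finset.mul_sum]
  rw [Finset.sum_comm]
  refine Finset.sum_congr rfl fun i _ => Finset.sum_congr rfl fun j _ => ?_
  rw [cartan_comm]; ring

lemma rootForm_simpleRefl_left (i : B) (c d : B → ℤ) :
    rootForm M (simpleRefl M i c) d = rootForm M c (simpleRefl M i d) := by
  rw [rootForm_comm c, simpleRefl_apply, simpleRefl_apply, rootForm_sub_left, rootForm_sub_left,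
    rootForm_smul_left, rootForm_smul_left, rootForm_single_left, rootForm_single_left,
    rootForm_comm c d]
  ring

variable (cs : CoxeterSystem M W) [SimplyLaced M]

/-- The action of a simply laced Coxeter group on its root lattice. -/
noncomputable def rootRep : W →* Module.End ℤ (B → ℤ) :=
  cs.lift ⟨simpleRefl M, simpleRefl_isLiftable⟩

lemma rootRep_simple (i : B) : rootRep cs (cs.simple i) = simpleRefl M i :=
  cs.lift_apply_simple _ i

lemma rootRep_mul_apply (x y : W) (c : B → ℤ) :
    rootRep cs (x * y) c = rootRep cs x (rootRep cs y c) := by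
  rw [map_mul, Module.End.mul_apply]

lemma rootRep_simple_mul (i : B) (w : W) (c : B → ℤ) :
    rootRep cs (cs.simple i * w) c = simpleRefl M i (rootRep cs w c) := by
  rw [rootRep_mul_apply, rootRep_simple]

lemma rootRep_mul_simple_self (w : W) (i : B) :
    rootRep cs (w * cs.simple i) (Pi.single i 1) = - rootRep cs w (Pi.single i 1) := by
  rw [rootRep_mul_apply, rootRep_simple, simpleRefl_single_self, map_neg]

lemma rootRep_inv_apply (w : W) (c : B → ℤ) : rootRep cs w⁻¹ (rootRep cs w c) = c := by
  rw [← rootRep_mul_apply, inv_mul_cancel, map_one, Module.End.one_apply]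

lemma rootRep_single_ne_zero (w : W) (i : B) : rootRep cs w (Pi.single i 1) ≠ 0 := by
  intro h
  have := rootRep_inv_apply cs w (Pi.single i 1)
  rw [h, map_zero] at this
  simpa using congrFun this i

/-- The rank two argument. Strip a right descent `s_j` from `w = v s_j`. If `s_i` and `s_j` commute,
`w α_i = v α_i` with `v` shorter. If they braid, `w α_i = v α_i + v α_j`: both terms are positive
when `v s_i > v`; otherwise `v = u s_i` and the sum collapses to `u α_j`, where `u s_j > u` by the
braid relation. -/
lemma rootRep_nonneg : ∀ (n : ℕ) (w : W) (i : B), cs.length w = n →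
    ¬ cs.IsRightDescent w i → 0 ≤ rootRep cs w (Pi.single i 1) := by
  intro n
  induction n using Nat.strong_induction_on with
  | _ n ih =>
  intro w i hn hi
  by_cases hw : w = 1
  · subst hw; simp [Pi.single_nonneg]
  obtain ⟨j, hj⟩ := cs.exists_rightDescent_of_ne_one hw
  have hij : j ≠ i := fun h => hi (h ▸ hj)
  obtain ⟨v, rfl⟩ : ∃ v, w = v * cs.simple j := ⟨w * cs.simple j, by simp⟩
  have hlv : cs.length (v * cs.simple j) = cs.length v + 1 := by
    have := cs.isRightDescent_iff.1 hj
    simpa using this.symm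
  have hvj : ¬ cs.IsRightDescent v j := by
    rw [cs.not_isRightDescent_iff]; exact hlv
  have hli := cs.not_isRightDescent_iff.1 hi
  have pj := ih _ (by omega) v j rfl hvj
  rcases SimplyLaced.eq_two_or_three (M := M) j i hij with h | h
  · have hc : cartan M j i = 0 := by simp [cartan, hij, h]
    have hcomm : cs.simple j * cs.simple i = cs.simple i * cs.simple j := by
      have := cs.simple_mul_simple_pow j i
      rw [h, pow_two] at this
      have h2 := mul_eq_one_iff_eq_inv.1 this
      simpa using h2
    have hvi : ¬ cs.IsRightDescent v i := by
      rw [cs.not_isRightDescent_iff]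
      have h1 : v * cs.simple j * cs.simple i = v * cs.simple i * cs.simple j := by
        rw [mul_assoc, hcomm, mul_assoc]
      rw [h1] at hli
      rcases cs.length_mul_simple (v * cs.simple i) j with h | h <;>
      rcases cs.length_mul_simple v i with h' | h' <;> omega
    have := ih _ (by omega) v i rfl hvi
    rwa [rootRep_mul_apply, rootRep_simple, simpleRefl_single, hc, zero_smul, sub_zero]
  · have hc : cartan M j i = -1 := by simp [cartan, hij, h]
    have hR : rootRep cs (v * cs.simple j) (Pi.single i 1) =
        rootRep cs v (Pi.single i 1) + rootRep cs v (Pi.single j 1) := by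
      rw [rootRep_mul_apply, rootRep_simple, simpleRefl_single, hc, map_sub, map_smul]; module
    by_cases hvi : cs.IsRightDescent v i
    · obtain ⟨u, rfl⟩ : ∃ u, v = u * cs.simple i := ⟨v * cs.simple i, by simp⟩
      have hlu : cs.length (u * cs.simple i) = cs.length u + 1 := by
        have := cs.isRightDescent_iff.1 hvi
        simpa using this.symm
      have hbraid : cs.simple i * cs.simple j * cs.simple i =
          cs.simple j * cs.simple i * cs.simple j := by
        have := cs.simple_mul_simple_pow i j
        rw [M.symmetric, h, pow_succ, pow_two] at this
        have h2 : (cs.simple i * cs.simple j * cs.simple i) *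
          (cs.simple j * cs.simple i * cs.simple j) = 1 := by simpa [mul_assoc] using this
        have h3 := mul_eq_one_iff_eq_inv.1 h2
        simpa [mul_assoc] using h3
      have huj : ¬ cs.IsRightDescent u j := by
        rw [cs.not_isRightDescent_iff]
        have h1 : u * cs.simple i * cs.simple j * cs.simple i =
            u * cs.simple j * cs.simple i * cs.simple j := by
          simpa [mul_assoc] using congrArg (u * ·) hbraid
        rw [h1] at hli
        rcases cs.length_mul_simple (u * cs.simple j * cs.simple i) j with h | h <;>
        rcases cs.length_mul_simple (u * cs.simple j) i with h' | h' <;>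
        rcases cs.length_mul_simple u j with h'' | h'' <;> omega
      have := ih _ (by omega) u j rfl huj
      have hc' : cartan M i j = -1 := by rw [cartan_comm, hc]
      rw [hR, rootRep_mul_simple_self, rootRep_mul_apply cs u, rootRep_simple,
        simpleRefl_single, hc', map_sub, map_smul]
      convert this using 1
      module
    · rw [hR]
      exact add_nonneg (ih _ (by omega) v i rfl hvi) pj

lemma rootRep_nonneg_iff {w : W} {i : B} :
    0 ≤ rootRep cs w (Pi.single i 1) ↔ ¬ cs.IsRightDescent w i := by
  refine ⟨fun h hd => ?_, rootRep_nonneg cs _ w i rfl⟩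
  have h1 := rootRep_nonneg cs _ (w * cs.simple i) i rfl
    (cs.isRightDescent_iff_not_isRightDescent_mul.1 hd)
  rw [rootRep_mul_simple_self] at h1
  exact rootRep_single_ne_zero cs w i (le_antisymm (neg_nonneg.1 h1) h)

lemma rootRep_nonpos_iff {w : W} {i : B} :
    rootRep cs w (Pi.single i 1) ≤ 0 ↔ cs.IsRightDescent w i := by
  rw [cs.isRightDescent_iff_not_isRightDescent_mul, ← rootRep_nonneg_iff cs,
    rootRep_mul_simple_self, neg_nonneg]

lemma rootRep_injective : Function.Injective (rootRep cs) := by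
  rw [injective_iff_map_eq_one]
  intro w hw
  by_contra h
  obtain ⟨i, hi⟩ := cs.exists_rightDescent_of_ne_one h
  rw [← rootRep_nonpos_iff cs, hw, Module.End.one_apply] at hi
  have := hi i
  simp at this

lemma rootForm_rootRep (w : W) (c d : B → ℤ) :
    rootForm M (rootRep cs w c) (rootRep cs w d) = rootForm M c d := by
  induction w using cs.simple_induction_left with
  | one => simp
  | mul_simple_left w i ih =>
    rw [rootRep_simple_mul, rootRep_simple_mul, rootForm_simpleRefl_left, ← Module.End.mul_apply,
      simpleRefl_mul_self, Module.End.one_apply, ih]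

lemma mul_simple_eq_simple_mul_of_rootRep_eq {w : W} {i j : B}
    (h : rootRep cs w (Pi.single i 1) = Pi.single j 1) :
    w * cs.simple i = cs.simple j * w := by
  apply rootRep_injective cs
  refine LinearMap.ext fun c => ?_
  rw [rootRep_simple_mul, rootRep_mul_apply, rootRep_simple, simpleRefl_apply, simpleRefl_apply,
    map_sub, map_smul, h, ← rootForm_single_left j, ← h, rootForm_rootRep, rootForm_single_left]

/-- A positive root that a simple reflection makes negative is the corresponding simple root. -/
lemma rootRep_eq_single_of_simpleRefl_nonpos {w : W} {i j : B}
    (h₁ : 0 ≤ rootRep cs w (Pi.single i 1))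
    (h₂ : simpleRefl M j (rootRep cs w (Pi.single i 1)) ≤ 0) :
    rootRep cs w (Pi.single i 1) = Pi.single j 1 := by
  set β := rootRep cs w (Pi.single i 1) with hβ
  have hz : ∀ k, k ≠ j → β k = 0 := by
    intro k hk
    have := h₂ k
    rw [simpleRefl_apply] at this
    simp only [Pi.sub_apply, Pi.smul_apply, Pi.single_eq_of_ne hk, smul_zero, sub_zero] at this
    exact le_antisymm this (h₁ k)
  have hβj : β = β j • Pi.single j 1 := by
    ext k
    by_cases hk : k = j
    · subst hk; simp
    · simp [hz k hk, Pi.single_eq_of_ne hk]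
  -- Applying `w⁻¹` to `β = β_j α_j` returns `α_i`, so the integer `β_j` is a unit; positivity makes
  -- it 1.
  have h3 := rootRep_inv_apply cs w (Pi.single i 1)
  rw [← hβ, hβj, map_smul] at h3
  have h4 := congrFun h3 i
  simp only [Pi.smul_apply, smul_eq_mul, Pi.single_eq_same] at h4
  have h5 : β j = 1 := by
    rcases Int.isUnit_iff.1 (IsUnit.of_mul_eq_one _ h4) with h | h
    · exact h
    · have := h₁ j
      rw [h] at this; simp at this
  rw [hβj, h5, one_smul]

end RootRepresentation

/-! ### Bruhat order and length -/

section BruhatOrder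

variable {B W : Type*} [Group W] {M : CoxeterMatrix B} (cs : CoxeterSystem M W)

lemma BruhatLE.length_le {x y : W} (h : BruhatLE cs x y) : cs.length x ≤ cs.length y := by
  induction h with
  | refl => exact le_rfl
  | tail _ h ih => obtain ⟨_, _, _, h⟩ := h; omega

lemma BruhatLE.length_lt {x y : W} (h : BruhatLE cs x y) (hne : x ≠ y) :
    cs.length x < cs.length y := by
  rcases Relation.ReflTransGen.cases_tail h with h' | ⟨z, hz, _, _, _, h'⟩
  · exact absurd h'.symm hne
  · exact (BruhatLE.length_le cs hz).trans_lt h'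

lemma bruhatLE_simple_mul {w : W} {i : B} (h : ¬ cs.IsLeftDescent w i) :
    BruhatLE cs w (cs.simple i * w) := by
  refine Relation.ReflTransGen.single ⟨w⁻¹ * cs.simple i * w, ?_, by group, ?_⟩
  · simpa using (cs.isReflection_simple i).conj w⁻¹
  · rw [cs.not_isLeftDescent_iff] at h; omega

end BruhatOrder

/-! ### Strong exchange, subwords and the lifting property -/

section Exchange

variable {B W : Type*} [Fintype B] [DecidableEq B] [Group W] {M : CoxeterMatrix B}
  (cs : CoxeterSystem M W) [SimplyLaced M]

lemma simple_mul_eq_mul_simple {w : W} {i j : B} (h₁ : ¬ cs.IsRightDescent w j)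
    (h₂ : cs.IsRightDescent (cs.simple i * w) j) : cs.simple i * w = w * cs.simple j := by
  rw [← rootRep_nonneg_iff cs] at h₁
  rw [← rootRep_nonpos_iff cs, rootRep_simple_mul] at h₂
  exact (mul_simple_eq_simple_mul_of_rootRep_eq cs
    (rootRep_eq_single_of_simpleRefl_nonpos cs h₁ h₂)).symm

lemma exists_rootRep_nonneg_of_isReflection {t : W} (ht : cs.IsReflection t) :
    ∃ u i, t = u * cs.simple i * u⁻¹ ∧ 0 ≤ rootRep cs u (Pi.single i 1) := by
  obtain ⟨u, i, rfl⟩ := ht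
  by_cases h : cs.IsRightDescent u i
  · refine ⟨u * cs.simple i, i, by simp [mul_assoc], ?_⟩
    rw [rootRep_nonneg_iff]
    exact cs.isRightDescent_iff_not_isRightDescent_mul.1 h
  · exact ⟨u, i, rfl, (rootRep_nonneg_iff cs).2 h⟩

/-- The strong exchange condition, in terms of the root of the reflection. -/
lemma exists_eraseIdx_of_rootRep_nonpos {u : W} {k : B}
    (hu : 0 ≤ rootRep cs u (Pi.single k 1)) (ω : List B)
    (h : rootRep cs (cs.wordProd ω * u) (Pi.single k 1) ≤ 0) :
    ∃ j < ω.length, cs.wordProd ω * (u * cs.simple k * u⁻¹) = cs.wordProd (ω.eraseIdx j) := by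
  induction ω with
  | nil =>
    rw [cs.wordProd_nil, one_mul] at h
    exact absurd (le_antisymm h hu) (rootRep_single_ne_zero cs u k)
  | cons i ω ih =>
    -- The letters act from the right end of the word. The letter to delete is the one at which the
    -- positive root `u α_k` turns negative, for there the root equals the simple root of that
    -- letter.
    by_cases h' : rootRep cs (cs.wordProd ω * u) (Pi.single k 1) ≤ 0
    · obtain ⟨j, hj, hj'⟩ := ih h'
      refine ⟨j + 1, by simpa using hj, ?_⟩
      rw [List.eraseIdx_cons_succ, cs.wordProd_cons, cs.wordProd_cons, mul_assoc, hj']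
    · rw [rootRep_nonpos_iff, ← rootRep_nonneg_iff] at h'
      rw [cs.wordProd_cons, mul_assoc, rootRep_simple_mul] at h
      have h3 := mul_simple_eq_simple_mul_of_rootRep_eq cs
        (rootRep_eq_single_of_simpleRefl_nonpos cs h' h)
      refine ⟨0, by simp, ?_⟩
      rw [List.eraseIdx_cons_zero, cs.wordProd_cons]
      have h4 : cs.wordProd ω * (u * cs.simple k * u⁻¹) = cs.simple i * cs.wordProd ω := by
        rw [← mul_assoc, ← mul_assoc, h3]; group
      rw [mul_assoc, h4, cs.simple_mul_simple_cancel_left]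

/-- The strong exchange condition. -/
theorem exists_eraseIdx_of_length_lt {t : W} (ht : cs.IsReflection t) (ω : List B)
    (h : cs.length (cs.wordProd ω * t) < cs.length (cs.wordProd ω)) :
    ∃ j < ω.length, cs.wordProd ω * t = cs.wordProd (ω.eraseIdx j) := by
  obtain ⟨u, k, rfl, hu⟩ := exists_rootRep_nonneg_of_isReflection cs ht
  refine exists_eraseIdx_of_rootRep_nonpos cs hu ω ?_
  -- If `ω` kept the root of `t` positive, a reduced word of `x = ω t` would make it negative, and
  -- deleting a letter from that word would give `ℓ(ω) < ℓ(ω t)`.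
  by_contra h'
  rw [rootRep_nonpos_iff, ← rootRep_nonneg_iff] at h'
  set x := cs.wordProd ω * (u * cs.simple k * u⁻¹) with hx
  obtain ⟨ω', hω', hxω⟩ := cs.exists_isReduced x
  have hxu : x * u = cs.wordProd ω * u * cs.simple k := by rw [hx]; group
  have h1 : rootRep cs (cs.wordProd ω' * u) (Pi.single k 1) ≤ 0 := by
    rw [← hxω, hxu, rootRep_mul_simple_self]
    exact neg_nonpos.2 h'
  obtain ⟨j, hj, hj'⟩ := exists_eraseIdx_of_rootRep_nonpos cs hu ω' h1
  have hback : x * (u * cs.simple k * u⁻¹) = cs.wordProd ω := by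
    rw [hx, mul_assoc, ht.mul_self, mul_one]
  rw [← hxω, hback] at hj'
  have h2 := cs.length_wordProd_le (ω'.eraseIdx j)
  rw [← hj', List.length_eraseIdx_of_lt hj] at h2
  have h3 := hω'.eq
  rw [← hxω] at h3
  omega

/-- Elements below `y` in the Bruhat order are products of subwords of any word for `y`. -/
lemma BruhatLE.exists_sublist {x : W} {ω : List B} (h : BruhatLE cs x (cs.wordProd ω)) :
    ∃ ω', ω'.Sublist ω ∧ x = cs.wordProd ω' := by
  induction h using Relation.ReflTransGen.head_induction_on with
  | refl => exact ⟨ω, List.Sublist.refl _, rfl⟩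
  | head h _ ih =>
    obtain ⟨ω', hω', rfl⟩ := ih
    obtain ⟨t, ht, heq, hlt⟩ := h
    have heq' := congrArg (· * t) heq
    simp only [mul_assoc, ht.mul_self, mul_one] at heq'
    rw [← heq'] at hlt
    obtain ⟨j, -, hj⟩ := exists_eraseIdx_of_length_lt cs ht ω' hlt
    exact ⟨ω'.eraseIdx j, (List.eraseIdx_sublist ..).trans hω', by rw [← heq', hj]⟩

/-- Strong exchange for `t` and a reduced word of `xt` that begins with `s_i`: the deleted letter is
the first one, since deleting any other would make `s_i x` shorter than `x`. -/
lemma simple_mul_eq_mul_isReflection {x t : W} {i : B} (ht : cs.IsReflection t)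
    (h₁ : cs.length (x * t) = cs.length x + 1) (h₂ : ¬ cs.IsLeftDescent x i)
    (h₃ : cs.IsLeftDescent (x * t) i) : cs.simple i * x = x * t := by
  obtain ⟨ω, hω, hωx⟩ := cs.exists_isReduced (cs.simple i * (x * t))
  have hy : x * t = cs.wordProd (i :: ω) := by
    rw [cs.wordProd_cons, ← hωx, cs.simple_mul_simple_cancel_left]
  have hx : cs.wordProd (i :: ω) * t = x := by rw [← hy, mul_assoc, ht.mul_self, mul_one]
  have hl := hω.eq
  rw [← hωx] at hl
  have h4 := cs.isLeftDescent_iff.1 h₃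
  have h5 := cs.not_isLeftDescent_iff.1 h₂
  obtain ⟨j, hj, hj'⟩ := exists_eraseIdx_of_length_lt cs ht (i :: ω) (by rw [hx, ← hy]; omega)
  rw [hx] at hj'
  cases j with
  | zero =>
    rw [List.eraseIdx_cons_zero, ← hωx] at hj'
    conv_lhs => rw [hj']
    rw [cs.simple_mul_simple_cancel_left]
  | succ j =>
    exfalso
    rw [List.eraseIdx_cons_succ, cs.wordProd_cons] at hj'
    have h6 : cs.simple i * x = cs.wordProd (ω.eraseIdx j) := by
      rw [hj', cs.simple_mul_simple_cancel_left]
    have h7 := cs.length_wordProd_le (ω.eraseIdx j)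
    rw [← h6, List.length_eraseIdx_of_lt (by simpa using hj)] at h7
    omega

/-- The lifting property of the Bruhat order. -/
lemma BruhatLE.simple_mul {x w : W} {i : B} (h : BruhatLE cs x w)
    (hw : ¬ cs.IsLeftDescent w i) : BruhatLE cs (cs.simple i * x) (cs.simple i * w) := by
  induction h using Relation.ReflTransGen.head_induction_on with
  | refl => exact Relation.ReflTransGen.refl
  | @head x y h hyw ih =>
    obtain ⟨t, ht, rfl, hlt⟩ := h
    by_cases hs : cs.length (cs.simple i * x) < cs.length (cs.simple i * (x * t))
    · exact Relation.ReflTransGen.head ⟨t, ht, by rw [mul_assoc], hs⟩ ih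
    -- If `s x` is not shorter than `s x t`, parity forces `ℓ(xt) = ℓ(x) + 1`, with `s` a left
    -- descent of `xt` but not of `x`. Then `s x = x t ≤ w ≤ s w`.
    · have hne := ht.length_mul_left_ne (cs.simple i * x)
      rw [mul_assoc] at hne
      have h1 : cs.length (x * t) = cs.length x + 1 ∧ ¬ cs.IsLeftDescent x i ∧
          cs.IsLeftDescent (x * t) i := by
        rw [cs.not_isLeftDescent_iff, cs.isLeftDescent_iff]
        have hne' := ht.length_mul_left_ne x
        have hpar : (cs.length (x * t) + cs.length (cs.simple i * (x * t))) % 2 = 1 ∧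
          (cs.length x + cs.length (cs.simple i * x)) % 2 = 1 := by
          rcases cs.length_simple_mul x i with h | h <;>
          rcases cs.length_simple_mul (x * t) i with h' | h' <;> omega
        have hpar2 : (cs.length (x * t)) % 2 = (cs.length x + cs.length t) % 2 :=
          cs.length_mul_mod_two x t
        have hodd := Nat.odd_iff.1 ht.odd_length
        rcases cs.length_simple_mul x i with h | h <;>
        rcases cs.length_simple_mul (x * t) i with h' | h' <;> omega
      rw [simple_mul_eq_mul_isReflection cs ht h1.1 h1.2.1 h1.2.2]
      exact Relation.ReflTransGen.trans hyw (bruhatLE_simple_mul cs hw)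

end Exchange

/-! ### The regular representation and linear independence of the `T_w` -/

section RegularRepresentation

variable {B W : Type*} [Group W] {M : CoxeterMatrix B} (cs : CoxeterSystem M W)

open Classical in
/-- Left multiplication by `T_s` on the free module on the symbols `T_w`. -/
noncomputable def leftOp (i : B) : Module.End Coeff (W →₀ Coeff) :=
  Finsupp.linearCombination Coeff fun x =>
    if cs.IsLeftDescent x i then
      (q - 1) • Finsupp.single x 1 + q • Finsupp.single (cs.simple i * x) 1
    else Finsupp.single (cs.simple i * x) 1

open Classical in
/-- Right multiplication by `T_s` on the free module on the symbols `T_w`. -/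
noncomputable def rightOp (i : B) : Module.End Coeff (W →₀ Coeff) :=
  Finsupp.linearCombination Coeff fun x =>
    if cs.IsRightDescent x i then
      (q - 1) • Finsupp.single x 1 + q • Finsupp.single (x * cs.simple i) 1
    else Finsupp.single (x * cs.simple i) 1

variable {cs}

lemma leftOp_single {x : W} {i : B} (h : ¬ cs.IsLeftDescent x i) :
    leftOp cs i (Finsupp.single x 1) = Finsupp.single (cs.simple i * x) 1 := by
  simp [leftOp, h]

lemma leftOp_single_of_isLeftDescent {x : W} {i : B} (h : cs.IsLeftDescent x i) :
    leftOp cs i (Finsupp.single x 1) =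
      (q - 1) • Finsupp.single x 1 + q • Finsupp.single (cs.simple i * x) 1 := by
  simp [leftOp, h]

lemma rightOp_single {x : W} {i : B} (h : ¬ cs.IsRightDescent x i) :
    rightOp cs i (Finsupp.single x 1) = Finsupp.single (x * cs.simple i) 1 := by
  simp [rightOp, h]

lemma rightOp_single_of_isRightDescent {x : W} {i : B} (h : cs.IsRightDescent x i) :
    rightOp cs i (Finsupp.single x 1) =
      (q - 1) • Finsupp.single x 1 + q • Finsupp.single (x * cs.simple i) 1 := by
  simp [rightOp, h]

lemma isLeftDescent_simple_mul_iff {x : W} {i : B} :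
    cs.IsLeftDescent (cs.simple i * x) i ↔ ¬ cs.IsLeftDescent x i := by
  rw [cs.isLeftDescent_iff_not_isLeftDescent_mul, cs.simple_mul_simple_cancel_left]

lemma leftOp_quadratic (i : B) : (leftOp cs i + 1) * (leftOp cs i - algebraMap _ _ q) = 0 := by
  refine Finsupp.lhom_ext' fun x => LinearMap.ext_ring ?_
  simp only [LinearMap.comp_apply, Finsupp.lsingle_apply, Module.End.mul_apply,
    LinearMap.sub_apply, LinearMap.add_apply, Module.End.one_apply, LinearMap.zero_apply,
    Module.algebraMap_end_apply]
  by_cases h : cs.IsLeftDescent x i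
  · have h' : ¬ cs.IsLeftDescent (cs.simple i * x) i := fun h' =>
      isLeftDescent_simple_mul_iff.1 h' h
    rw [leftOp_single_of_isLeftDescent h]
    simp only [map_sub, map_add, map_smul, leftOp_single_of_isLeftDescent h, leftOp_single h',
      cs.simple_mul_simple_cancel_left]
    module
  · have h' := isLeftDescent_simple_mul_iff.2 h
    rw [leftOp_single h]
    simp only [map_sub, map_smul, leftOp_single_of_isLeftDescent h', leftOp_single h,
      cs.simple_mul_simple_cancel_left]
    module

/-- The dichotomy behind the commutation of left and right multiplication: unless the two sides do
not interfere, the lengths of `x`, `s_i x`, `x s_j`, `s_i x s_j` force the exchange case. -/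
lemma descent_iff_or_simple_mul_eq [Fintype B] [DecidableEq B] [SimplyLaced M] (x : W) (i j : B) :
    ((cs.IsLeftDescent (x * cs.simple j) i ↔ cs.IsLeftDescent x i) ∧
      (cs.IsRightDescent (cs.simple i * x) j ↔ cs.IsRightDescent x j)) ∨
      cs.simple i * x = x * cs.simple j := by
  by_cases h1 : cs.IsLeftDescent (x * cs.simple j) i ∧ ¬ cs.IsLeftDescent x i
  · right
    obtain ⟨hC, hA⟩ := h1
    have hC' := cs.isLeftDescent_iff.1 hC
    have hA' := cs.not_isLeftDescent_iff.1 hA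
    rw [← mul_assoc] at hC'
    apply simple_mul_eq_mul_simple cs
    · rw [cs.not_isRightDescent_iff]
      rcases cs.length_mul_simple x j with h | h <;>
      rcases cs.length_mul_simple (cs.simple i * x) j with h' | h' <;> omega
    · rw [cs.isRightDescent_iff]
      rcases cs.length_mul_simple x j with h | h <;>
      rcases cs.length_mul_simple (cs.simple i * x) j with h' | h' <;> omega
  by_cases h2 : ¬ cs.IsLeftDescent (x * cs.simple j) i ∧ cs.IsLeftDescent x i
  · right
    obtain ⟨hC, hA⟩ := h2
    have hC' := cs.not_isLeftDescent_iff.1 hC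
    have hA' := cs.isLeftDescent_iff.1 hA
    rw [← mul_assoc] at hC'
    have h3 : cs.simple i * (cs.simple i * x) = cs.simple i * x * cs.simple j := by
      apply simple_mul_eq_mul_simple cs
      · rw [cs.not_isRightDescent_iff]
        rcases cs.length_mul_simple x j with h | h <;>
        rcases cs.length_mul_simple (cs.simple i * x) j with h' | h' <;> omega
      · rw [cs.simple_mul_simple_cancel_left, cs.isRightDescent_iff]
        rcases cs.length_mul_simple x j with h | h <;>
        rcases cs.length_mul_simple (cs.simple i * x) j with h' | h' <;> omega
    rw [cs.simple_mul_simple_cancel_left] at h3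
    conv_lhs => rw [h3, mul_assoc, cs.simple_mul_simple_cancel_left]
  · left
    refine ⟨by tauto, ?_⟩
    have h3 : cs.IsLeftDescent (x * cs.simple j) i ↔ cs.IsLeftDescent x i := by tauto
    rw [cs.isLeftDescent_iff, cs.isLeftDescent_iff, ← mul_assoc] at h3
    rw [cs.isRightDescent_iff, cs.isRightDescent_iff]
    rcases cs.length_mul_simple x j with h | h <;>
    rcases cs.length_mul_simple (cs.simple i * x) j with h' | h' <;>
    rcases cs.length_simple_mul x i with h'' | h'' <;>
    rcases cs.length_simple_mul (x * cs.simple j) i with h''' | h''' <;>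
    rw [← mul_assoc] at h''' <;> omega

lemma leftOp_commute_rightOp [Fintype B] [DecidableEq B] [SimplyLaced M] (i j : B) :
    Commute (leftOp cs i) (rightOp cs j) := by
  refine Finsupp.lhom_ext' fun x => LinearMap.ext_ring ?_
  simp only [LinearMap.comp_apply, Finsupp.lsingle_apply, Module.End.mul_apply]
  rcases descent_iff_or_simple_mul_eq (cs := cs) x i j with ⟨h₁, h₂⟩ | h
  · by_cases hA : cs.IsLeftDescent x i <;> by_cases hB : cs.IsRightDescent x j
    · rw [leftOp_single_of_isLeftDescent hA, rightOp_single_of_isRightDescent hB]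
      simp only [map_add, map_smul, leftOp_single_of_isLeftDescent hA,
        rightOp_single_of_isRightDescent hB, leftOp_single_of_isLeftDescent (h₁.2 hA),
        rightOp_single_of_isRightDescent (h₂.2 hB), mul_assoc]
      module
    · rw [leftOp_single_of_isLeftDescent hA, rightOp_single hB]
      simp only [map_add, map_smul,
        rightOp_single hB, leftOp_single_of_isLeftDescent (h₁.2 hA),
        rightOp_single (mt h₂.1 hB), mul_assoc]
    · rw [leftOp_single hA, rightOp_single_of_isRightDescent hB]
      simp only [map_add, map_smul, leftOp_single hA, leftOp_single (mt h₁.1 hA),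
        rightOp_single_of_isRightDescent (h₂.2 hB), mul_assoc]
    · rw [leftOp_single hA, rightOp_single hB, leftOp_single (mt h₁.1 hA),
        rightOp_single (mt h₂.1 hB), mul_assoc]
  -- Here `s_i x = x s_j`, and the left and right operators agree on both `T_x` and `T_{x s_j}`, the
  -- only basis vectors involved.
  · have hAB : cs.IsLeftDescent x i ↔ cs.IsRightDescent x j := by
      rw [CoxeterSystem.IsLeftDescent, CoxeterSystem.IsRightDescent, h]
    have hl : leftOp cs i (Finsupp.single x 1) = rightOp cs j (Finsupp.single x 1) := by
      by_cases hA : cs.IsLeftDescent x i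
      · rw [leftOp_single_of_isLeftDescent hA, rightOp_single_of_isRightDescent (hAB.1 hA), h]
      · rw [leftOp_single hA, rightOp_single (mt hAB.2 hA), h]
    have h' : cs.simple i * (x * cs.simple j) = x * cs.simple j * cs.simple j := by
      rw [← h, cs.simple_mul_simple_cancel_left, h, cs.simple_mul_simple_cancel_right]
    have hl' : leftOp cs i (Finsupp.single (x * cs.simple j) 1) =
        rightOp cs j (Finsupp.single (x * cs.simple j) 1) := by
      have hAB' : cs.IsLeftDescent (x * cs.simple j) i ↔ cs.IsRightDescent (x * cs.simple j) j := by
        rw [CoxeterSystem.IsLeftDescent, CoxeterSystem.IsRightDescent, h']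
      by_cases hA : cs.IsLeftDescent (x * cs.simple j) i
      · rw [leftOp_single_of_isLeftDescent hA, rightOp_single_of_isRightDescent (hAB'.1 hA), h']
      · rw [leftOp_single hA, rightOp_single (mt hAB'.2 hA), h']
    rw [hl]
    by_cases hB : cs.IsRightDescent x j
    · rw [rightOp_single_of_isRightDescent hB, map_add, map_add, map_smul, map_smul, map_smul,
        map_smul, hl, hl']
    · rw [rightOp_single hB, hl']

variable (cs)

/-- The product of the operators `leftOp` along a word. -/
noncomputable def leftWord (ω : List B) : Module.End Coeff (W →₀ Coeff) :=
  (ω.map (leftOp cs)).prod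

variable {cs}

lemma leftWord_single (ω : List B) (y : W)
    (h : cs.length (cs.wordProd ω * y) = ω.length + cs.length y) :
    leftWord cs ω (Finsupp.single y 1) = Finsupp.single (cs.wordProd ω * y) 1 := by
  induction ω with
  | nil => simp [leftWord]
  | cons i ω ih =>
    rw [cs.wordProd_cons, mul_assoc] at h ⊢
    rw [List.length_cons] at h
    have h1 := cs.length_mul_le (cs.wordProd ω) y
    have h2 := cs.length_wordProd_le ω
    have h3 : cs.length (cs.wordProd ω * y) = ω.length + cs.length y := by
      rcases cs.length_simple_mul (cs.wordProd ω * y) i with h | h <;> omega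
    have h4 : ¬ cs.IsLeftDescent (cs.wordProd ω * y) i := by
      rw [cs.not_isLeftDescent_iff]; omega
    have h5 := ih h3
    rw [leftWord] at h5
    rw [leftWord, List.map_cons, List.prod_cons, Module.End.mul_apply, h5, leftOp_single h4]

variable [Fintype B] [DecidableEq B] [SimplyLaced M]

lemma leftWord_commute_rightOp (ω : List B) (j : B) : Commute (leftWord cs ω) (rightOp cs j) := by
  apply Commute.list_prod_left
  intro f hf
  obtain ⟨i, -, rfl⟩ := List.mem_map.1 hf
  exact leftOp_commute_rightOp i j

omit [Fintype B] [DecidableEq B] [SimplyLaced M] in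
-- The right operators carry `T_1` to every `T_x` along a reduced word. This makes `leftElt`
-- independent of the chosen reduced word and yields the Hecke relations without Matsumoto's
-- theorem.
lemma end_ext_of_commute_rightOp {f g : Module.End Coeff (W →₀ Coeff)}
    (hf : ∀ j, Commute f (rightOp cs j)) (hg : ∀ j, Commute g (rightOp cs j))
    (h : f (Finsupp.single 1 1) = g (Finsupp.single 1 1)) : f = g := by
  have key : ∀ (n : ℕ) (x : W), cs.length x = n →
      f (Finsupp.single x 1) = g (Finsupp.single x 1) := by
    intro n
    induction n with
    | zero =>
      intro x hx
      rw [cs.length_eq_zero_iff.1 hx, h]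
    | succ n ih =>
      intro x hx
      have hx1 : x ≠ 1 := by rintro rfl; simp at hx
      obtain ⟨j, hj⟩ := cs.exists_rightDescent_of_ne_one hx1
      have hj' := cs.isRightDescent_iff_not_isRightDescent_mul.1 hj
      have h1 := ih (x * cs.simple j) (by have := cs.isRightDescent_iff.1 hj; omega)
      have h2 := rightOp_single hj'
      rw [cs.simple_mul_simple_cancel_right] at h2
      rw [← h2, ← Module.End.mul_apply, ← Module.End.mul_apply, (hf j).eq, (hg j).eq,
        Module.End.mul_apply, Module.End.mul_apply, h1]
  exact Finsupp.lhom_ext' fun x => LinearMap.ext_ring (key _ x rfl)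

variable (cs) in
/-- The operator by which `T_w` acts in the left regular representation. -/
noncomputable def leftElt (w : W) : Module.End Coeff (W →₀ Coeff) :=
  leftWord cs (cs.exists_isReduced w).choose

lemma leftElt_commute_rightOp (w : W) (j : B) : Commute (leftElt cs w) (rightOp cs j) :=
  leftWord_commute_rightOp _ j

omit [Fintype B] [DecidableEq B] [SimplyLaced M] in
lemma leftElt_single {w y : W} (h : cs.length (w * y) = cs.length w + cs.length y) :
    leftElt cs w (Finsupp.single y 1) = Finsupp.single (w * y) 1 := by
  obtain ⟨h1, h2⟩ := (cs.exists_isReduced w).choose_spec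
  rw [leftElt]
  conv_rhs => rw [h2]
  apply leftWord_single
  rw [← h1.eq, ← h2, h]

omit [Fintype B] [DecidableEq B] [SimplyLaced M] in
lemma leftElt_single_one (w : W) : leftElt cs w (Finsupp.single 1 1) = Finsupp.single w 1 := by
  rw [leftElt_single] <;> simp

lemma leftElt_one : leftElt cs 1 = 1 :=
  end_ext_of_commute_rightOp (leftElt_commute_rightOp 1) (fun _ => Commute.one_left _)
    (by rw [leftElt_single_one, Module.End.one_apply])

lemma leftElt_mul {x y : W} (h : cs.length (x * y) = cs.length x + cs.length y) :
    leftElt cs x * leftElt cs y = leftElt cs (x * y) :=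
  end_ext_of_commute_rightOp
    (fun j => (leftElt_commute_rightOp x j).mul_left (leftElt_commute_rightOp y j))
    (leftElt_commute_rightOp _)
    (by rw [Module.End.mul_apply, leftElt_single_one, leftElt_single h, leftElt_single_one])

lemma leftElt_simple (i : B) : leftElt cs (cs.simple i) = leftOp cs i :=
  end_ext_of_commute_rightOp (leftElt_commute_rightOp _) (leftOp_commute_rightOp i)
    (by rw [leftElt_single_one, leftOp_single (cs.not_isLeftDescent_one i), mul_one])

variable (cs)

/-- The left regular representation of the Hecke algebra on the free module on `W`. -/
noncomputable def regularRep : HeckeAlgebra cs →ₐ[Coeff] Module.End Coeff (W →₀ Coeff) :=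
  RingQuot.liftAlgHom Coeff ⟨FreeAlgebra.lift Coeff (leftElt cs), by
    intro a b h
    induction h with
    | one => rw [FreeAlgebra.lift_ι_apply, leftElt_one, map_one]
    | mul x y h => simp only [map_mul, FreeAlgebra.lift_ι_apply, leftElt_mul h]
    | quadratic i =>
      simp only [map_mul, map_add, map_sub, FreeAlgebra.lift_ι_apply, leftElt_simple, map_one,
        AlgHom.commutes, leftOp_quadratic, map_zero]⟩

lemma regularRep_heckeT (w : W) : regularRep cs (heckeT cs w) = leftElt cs w := by
  have h : regularRep cs (heckeMk cs (FreeAlgebra.ι Coeff w)) =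
      FreeAlgebra.lift Coeff (leftElt cs) (FreeAlgebra.ι Coeff w) :=
    RingQuot.liftAlgHom_mkAlgHom_apply ..
  rw [heckeT, h, FreeAlgebra.lift_ι_apply]

/-- The coordinates of an element of the Hecke algebra in the standard basis. -/
noncomputable def coords : HeckeAlgebra cs →ₗ[Coeff] (W →₀ Coeff) :=
  (LinearMap.applyₗ (Finsupp.single 1 1)).comp (regularRep cs).toLinearMap

lemma coords_heckeT (w : W) : coords cs (heckeT cs w) = Finsupp.single w 1 := by
  simp [coords, regularRep_heckeT, leftElt_single_one]

lemma coords_heckeT_simple_mul (i : B) (h : HeckeAlgebra cs) :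
    coords cs (heckeT cs (cs.simple i) * h) = leftOp cs i (coords cs h) := by
  simp [coords, regularRep_heckeT, leftElt_simple]

end RegularRepresentation

/-! ### Powers of `v` and self-dual polynomials -/

section Powers

lemma vpow_add (m n : ℤ) : vpow (m + n) = vpow m * vpow n := LaurentPolynomial.T_add m n

lemma vpow_zero : vpow 0 = 1 := LaurentPolynomial.T_zero

lemma q_mul_qInv : q * qInv = 1 := by
  rw [q, qInv, ← vpow_add, add_neg_cancel, vpow_zero]

lemma qInv_mul_q : qInv * q = 1 := by rw [mul_comm, q_mul_qInv]

lemma q_pow (k : ℕ) : q ^ k = vpow (2 * k) := by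
  rw [q, vpow, vpow, LaurentPolynomial.T_pow, mul_comm]

lemma qInv_pow (k : ℕ) : qInv ^ k = vpow (-(2 * k)) := by
  rw [qInv, vpow, vpow, LaurentPolynomial.T_pow]; congr 1; ring

lemma vpow_mul_cancel_left {n : ℤ} {a b : Coeff} (h : vpow n * a = vpow n * b) : a = b := by
  have := congrArg (vpow (-n) * ·) h
  simpa only [← mul_assoc, ← vpow_add, neg_add_cancel, vpow_zero, one_mul] using this

lemma aeval_q_injective : Function.Injective (aeval q : ℤ[X] →ₐ[ℤ] Coeff) := by
  have h : (aeval q : ℤ[X] →ₐ[ℤ] Coeff) = (toLaurentAlg).comp (expand ℤ 2) := by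
    ext1
    simp [q, vpow]
  rw [h]
  exact toLaurent_injective.comp (expand_injective two_pos)

lemma aeval_qInv (p : ℤ[X]) : (aeval qInv p : Coeff) = aeval q p.reverse * qInv ^ p.natDegree := by
  let _ : Invertible qInv := ⟨q, q_mul_qInv, qInv_mul_q⟩
  exact (eval₂_reverse_mul_pow (algebraMap ℤ Coeff) qInv p).symm

/-- A polynomial of degree less than `(n - l) / 2` that is self-dual with respect to the
centre `(n - l) / 2` is zero. -/
lemma eq_zero_of_selfDual {p : ℤ[X]} {n l : ℕ} (hd : 2 * p.natDegree + 1 + l ≤ n)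
    (h : vpow n * aeval qInv p * vpow (-(2 * l)) = vpow (-n) * aeval q p) : p = 0 := by
  by_contra hp
  obtain ⟨m, rfl⟩ : ∃ m, n = l + p.natDegree + m := ⟨n - (l + p.natDegree), by omega⟩
  -- Self-duality says that `p` is its own reversal times `X ^ m`. The degree bound gives `m > deg
  -- p`, which is impossible for `p ≠ 0`.
  have h1 : aeval q (p.reverse * X ^ m) = (aeval q p : Coeff) := by
    apply vpow_mul_cancel_left (n := -((l + p.natDegree + m : ℕ) : ℤ))
    rw [← h, aeval_qInv, map_mul, map_pow, aeval_X, qInv_pow, q_pow]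
    have : vpow (-((l + p.natDegree + m : ℕ) : ℤ)) * vpow (2 * m) =
        vpow ((l + p.natDegree + m : ℕ) : ℤ) * vpow (-(2 * p.natDegree)) * vpow (-(2 * l)) := by
      rw [← vpow_add, ← vpow_add, ← vpow_add]
      congr 1; push_cast; ring
    linear_combination (aeval q p.reverse) * this
  have h2 := aeval_q_injective h1
  have h3 : p.reverse ≠ 0 := by rwa [Ne, reverse_eq_zero]
  have h4 := congrArg natDegree h2
  rw [natDegree_mul_X_pow _ h3] at h4
  omega

end Powers

/-! ### Inverses in the Hecke algebra and triangularity of the bar involution -/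

section HeckeRelations

variable {B W : Type*} [Group W] {M : CoxeterMatrix B} (cs : CoxeterSystem M W)

lemma heckeT_one : heckeT cs 1 = 1 := by
  have := RingQuot.mkAlgHom_rel Coeff (HeckeRel.one (cs := cs))
  rw [map_one] at this
  exact this

lemma heckeT_mul {x y : W} (h : cs.length (x * y) = cs.length x + cs.length y) :
    heckeT cs x * heckeT cs y = heckeT cs (x * y) := by
  have := RingQuot.mkAlgHom_rel Coeff (HeckeRel.mul (cs := cs) x y h)
  rw [map_mul] at this
  exact this

lemma heckeT_quadratic (i : B) :
    (heckeT cs (cs.simple i) + 1) * (heckeT cs (cs.simple i) - algebraMap Coeff _ q) = 0 := by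
  have := RingQuot.mkAlgHom_rel Coeff (HeckeRel.quadratic (cs := cs) i)
  rw [map_mul, map_add, map_sub, map_one, AlgHom.commutes, map_zero] at this
  exact this

lemma heckeT_simple_sq (i : B) : heckeT cs (cs.simple i) * heckeT cs (cs.simple i) =
    (q - 1) • heckeT cs (cs.simple i) + q • 1 := by
  have h := heckeT_quadratic cs i
  rw [Algebra.algebraMap_eq_smul_one, add_mul, mul_sub, mul_smul_comm, mul_one, one_mul] at h
  rw [← sub_eq_zero, ← h]
  module

variable {cs}

lemma heckeT_simple_mul {x : W} {i : B} (h : ¬ cs.IsLeftDescent x i) :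
    heckeT cs (cs.simple i) * heckeT cs x = heckeT cs (cs.simple i * x) := by
  apply heckeT_mul
  rw [cs.not_isLeftDescent_iff.1 h, cs.length_simple, add_comm]

variable (cs)

/-- The inverse of `T_s`. -/
noncomputable def simpleInv (i : B) : HeckeAlgebra cs :=
  qInv • heckeT cs (cs.simple i) + (qInv - 1) • 1

lemma heckeT_mul_simpleInv (i : B) : heckeT cs (cs.simple i) * simpleInv cs i = 1 := by
  rw [simpleInv, mul_add, mul_smul_comm, mul_smul_comm, heckeT_simple_sq, mul_one, smul_add,
    smul_smul, smul_smul, qInv_mul_q, mul_sub, qInv_mul_q]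
  module

lemma simpleInv_mul_heckeT (i : B) : simpleInv cs i * heckeT cs (cs.simple i) = 1 := by
  rw [← heckeT_mul_simpleInv cs i, simpleInv, mul_add, add_mul, mul_smul_comm, smul_mul_assoc,
    smul_mul_assoc, mul_smul_comm, one_mul, mul_one]

lemma q_smul_simpleInv_add_one (i : B) :
    q • (simpleInv cs i + 1) = heckeT cs (cs.simple i) + 1 := by
  rw [simpleInv, smul_add, smul_add, smul_smul, smul_smul, q_mul_qInv, mul_sub, q_mul_qInv]
  module

lemma simpleInv_add_one_mul (i : B) :
    (simpleInv cs i + 1) * simpleInv cs i = qInv • (simpleInv cs i + 1) := by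
  have h : simpleInv cs i + 1 = qInv • (heckeT cs (cs.simple i) + 1) := by
    rw [← q_smul_simpleInv_add_one, smul_smul, qInv_mul_q, one_smul]
  conv_lhs => rw [h, smul_mul_assoc, add_mul, heckeT_mul_simpleInv, one_mul, add_comm]

/-- The bar conjugate of `T_x`, that is, the inverse of `T_{x⁻¹}`. -/
noncomputable def heckeTBar (x : W) : HeckeAlgebra cs := Ring.inverse (heckeT cs x⁻¹)

lemma ring_inverse_eq {R : Type*} [Ring R] {a b : R} (h₁ : a * b = 1) (h₂ : b * a = 1) :
    Ring.inverse a = b :=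
  Ring.inverse_unit ⟨a, b, h₁, h₂⟩

lemma heckeTBar_one : heckeTBar cs 1 = 1 := by
  rw [heckeTBar, inv_one, heckeT_one, Ring.inverse_one]

/-- `Ring.inverse` is `0` on non-units, so `heckeTBar` has its intended meaning only through this
lemma. -/
lemma isUnit_heckeT : ∀ (n : ℕ) (x : W), cs.length x = n → IsUnit (heckeT cs x) := by
  intro n
  induction n with
  | zero => intro x hx; rw [cs.length_eq_zero_iff.1 hx, heckeT_one]; exact isUnit_one
  | succ n ih =>
    intro x hx
    have hx1 : x ≠ 1 := by rintro rfl; simp at hx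
    obtain ⟨i, hi⟩ := cs.exists_leftDescent_of_ne_one hx1
    have h1 := heckeT_simple_mul (cs.isLeftDescent_iff_not_isLeftDescent_mul.1 hi)
    rw [cs.simple_mul_simple_cancel_left] at h1
    rw [← h1]
    refine IsUnit.mul ⟨⟨_, _, heckeT_mul_simpleInv cs i, simpleInv_mul_heckeT cs i⟩, rfl⟩ (ih _ ?_)
    have := cs.isLeftDescent_iff.1 hi
    omega

variable {cs}

lemma heckeTBar_simple_mul {x : W} {i : B} (h : ¬ cs.IsLeftDescent x i) :
    heckeTBar cs (cs.simple i * x) = simpleInv cs i * heckeTBar cs x := by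
  have h1 : heckeT cs x⁻¹ * heckeT cs (cs.simple i) = heckeT cs (cs.simple i * x)⁻¹ := by
    rw [mul_inv_rev, cs.inv_simple]
    apply heckeT_mul
    rw [cs.length_simple, ← cs.length_inv (x⁻¹ * cs.simple i), mul_inv_rev, inv_inv, cs.inv_simple,
      cs.length_inv, cs.not_isLeftDescent_iff.1 h]
  have hu := isUnit_heckeT cs _ x⁻¹ rfl
  rw [heckeTBar, ← h1]
  apply ring_inverse_eq
  · rw [heckeTBar, mul_assoc, ← mul_assoc (heckeT cs (cs.simple i)), heckeT_mul_simpleInv, one_mul,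
      Ring.mul_inverse_cancel _ hu]
  · rw [heckeTBar, mul_assoc, ← mul_assoc (Ring.inverse _), Ring.inverse_mul_cancel _ hu, one_mul,
      simpleInv_mul_heckeT]

lemma leftOp_apply (f : W →₀ Coeff) (i : B) (z : W) [Decidable (cs.IsLeftDescent z i)] :
    leftOp cs i f z = if cs.IsLeftDescent z i then f (cs.simple i * z) + (q - 1) * f z
      else q * f (cs.simple i * z) := by
  induction f using Finsupp.induction_linear with
  | zero => simp
  | add f g hf hg =>
    rw [map_add, Finsupp.add_apply, hf, hg]
    split_ifs <;> simp only [Finsupp.add_apply] <;> ring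
  | single x a =>
    have h0 : Finsupp.single x a = a • Finsupp.single x (1 : Coeff) := by simp
    classical
    have hiff : x = cs.simple i * z ↔ cs.simple i * x = z := by
      constructor <;> rintro rfl <;> simp
    have hne : cs.simple i * x ≠ x := fun h => cs.length_simple_mul_ne x i (by rw [h])
    rw [h0, map_smul]
    by_cases hx : cs.IsLeftDescent x i
    · rw [leftOp_single_of_isLeftDescent hx]
      by_cases hz : x = z
      · subst hz
        simp [hx, hne, hne.symm, mul_comm]
      · by_cases hz' : cs.simple i * x = z
        · have hz'' : ¬ cs.IsLeftDescent z i := by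
            rw [← hz', isLeftDescent_simple_mul_iff, not_not]; exact hx
          simp [Finsupp.single_apply, hiff, hz, hz', hz'', mul_comm]
        · simp [hiff, hz, hz']
    · rw [leftOp_single hx]
      by_cases hz : x = z
      · subst hz
        simp [hx, hne, hne.symm]
      · by_cases hz' : cs.simple i * x = z
        · have hz'' : cs.IsLeftDescent z i := by
            rw [← hz', isLeftDescent_simple_mul_iff]; exact hx
          simp [Finsupp.single_apply, hiff, hz, hz', hz'']
        · simp [hiff, hz, hz']

variable [Fintype B] [DecidableEq B] [SimplyLaced M]

/-- The bar conjugate of `T_y` is `q ^ (-ℓ(y)) T_y` up to standard basis elements of smaller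
length. -/
lemma coords_heckeTBar (n : ℕ) : ∀ y : W, cs.length y = n →
    coords cs (heckeTBar cs y) y = vpow (-(2 * n)) ∧
      ∀ z, z ≠ y → n ≤ cs.length z → coords cs (heckeTBar cs y) z = 0 := by
  classical
  induction n with
  | zero =>
    intro y hy
    rw [cs.length_eq_zero_iff.1 hy, heckeTBar_one, ← heckeT_one, coords_heckeT]
    refine ⟨by simp [vpow_zero], fun z hz _ => by simp [hz.symm]⟩
  | succ n ih =>
    intro y hy
    have hy1 : y ≠ 1 := by rintro rfl; simp at hy
    obtain ⟨i, hi⟩ := cs.exists_leftDescent_of_ne_one hy1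
    have hi' := cs.isLeftDescent_iff_not_isLeftDescent_mul.1 hi
    have hl := cs.isLeftDescent_iff.1 hi
    have h1 := heckeTBar_simple_mul hi'
    rw [cs.simple_mul_simple_cancel_left] at h1
    obtain ⟨ih1, ih2⟩ := ih (cs.simple i * y) (by omega)
    set m := coords cs (heckeTBar cs (cs.simple i * y)) with hm
    have h2 : coords cs (heckeTBar cs y) = qInv • leftOp cs i m + (qInv - 1) • m := by
      rw [h1, simpleInv, add_mul, smul_mul_assoc, smul_mul_assoc, one_mul, map_add, map_smul,
        map_smul, coords_heckeT_simple_mul]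
    have hmy : ∀ z, n + 1 ≤ cs.length z → m z = 0 := fun z hz =>
      ih2 z (by rintro rfl; omega) (by omega)
    rw [h2]
    simp only [Finsupp.add_apply, Finsupp.smul_apply, leftOp_apply, smul_eq_mul]
    constructor
    · rw [if_pos hi, hmy y (by omega), ih1, mul_zero, mul_zero, add_zero, add_zero, qInv,
        ← vpow_add]
      congr 1; push_cast; ring
    · intro z hz hzl
      rw [hmy z hzl]
      have h3 : m (cs.simple i * z) = 0 := by
        apply ih2
        · intro h; exact hz (mul_left_cancel h)
        · rcases cs.length_simple_mul z i with h | h <;> omega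
      rw [h3]; simp

end HeckeRelations

/-! ### Bar invariant elements -/

section BarInvariance

variable {B W : Type*} [Group W] {M : CoxeterMatrix B} (cs : CoxeterSystem M W)

/-- The element `∑ x, f_x(q) T_x` of the Hecke algebra. -/
noncomputable def stdSum : (W →₀ ℤ[X]) →+ HeckeAlgebra cs :=
  Finsupp.liftAddHom fun x =>
    (AddMonoidHom.flip (AddMonoidHom.smul (R := Coeff)) (heckeT cs x)).comp
      (aeval q : ℤ[X] →ₐ[ℤ] Coeff).toAddMonoidHom

/-- The bar conjugate of the element `∑ x, f_x(q) T_x` of the Hecke algebra. -/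
noncomputable def barSum : (W →₀ ℤ[X]) →+ HeckeAlgebra cs :=
  Finsupp.liftAddHom fun x =>
    (AddMonoidHom.flip (AddMonoidHom.smul (R := Coeff)) (heckeTBar cs x)).comp
      (aeval qInv : ℤ[X] →ₐ[ℤ] Coeff).toAddMonoidHom

lemma stdSum_apply (f : W →₀ ℤ[X]) :
    stdSum cs f = f.sum fun x p => (aeval q p : Coeff) • heckeT cs x := rfl

lemma barSum_apply (f : W →₀ ℤ[X]) :
    barSum cs f = f.sum fun x p => (aeval qInv p : Coeff) • heckeTBar cs x := rfl

lemma stdSum_single (x : W) (p : ℤ[X]) :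
    stdSum cs (Finsupp.single x p) = (aeval q p : Coeff) • heckeT cs x := by
  rw [stdSum_apply, Finsupp.sum_single_index]; simp

lemma barSum_single (x : W) (p : ℤ[X]) :
    barSum cs (Finsupp.single x p) = (aeval qInv p : Coeff) • heckeTBar cs x := by
  rw [barSum_apply, Finsupp.sum_single_index]; simp

lemma stdSum_smul (r : ℤ[X]) (f : W →₀ ℤ[X]) :
    stdSum cs (r • f) = (aeval q r : Coeff) • stdSum cs f := by
  induction f using Finsupp.induction_linear with
  | zero => simp
  | add f g hf hg => rw [smul_add, map_add, hf, hg, map_add, smul_add]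
  | single x p => rw [Finsupp.smul_single, stdSum_single, stdSum_single, smul_eq_mul, map_mul,
      smul_smul]

lemma barSum_smul (r : ℤ[X]) (f : W →₀ ℤ[X]) :
    barSum cs (r • f) = (aeval qInv r : Coeff) • barSum cs f := by
  induction f using Finsupp.induction_linear with
  | zero => simp
  | add f g hf hg => rw [smul_add, map_add, hf, hg, map_add, smul_add]
  | single x p => rw [Finsupp.smul_single, barSum_single, barSum_single, smul_eq_mul, map_mul,
      smul_smul]

/-- The element `v ^ (-n) * ∑ x, f_x(q) T_x` is fixed by the bar involution. -/
def IsBarInvariant (n : ℕ) (f : W →₀ ℤ[X]) : Prop :=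
  vpow n • barSum cs f = vpow (-n) • stdSum cs f

variable {cs}

lemma IsBarInvariant.zero (n : ℕ) : IsBarInvariant cs n 0 := by simp [IsBarInvariant]

lemma IsBarInvariant.add {n : ℕ} {f g : W →₀ ℤ[X]} (hf : IsBarInvariant cs n f)
    (hg : IsBarInvariant cs n g) : IsBarInvariant cs n (f + g) := by
  rw [IsBarInvariant] at *
  rw [map_add, map_add, smul_add, smul_add, hf, hg]

lemma IsBarInvariant.sub {n : ℕ} {f g : W →₀ ℤ[X]} (hf : IsBarInvariant cs n f)
    (hg : IsBarInvariant cs n g) : IsBarInvariant cs n (f - g) := by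
  rw [IsBarInvariant] at *
  rw [map_sub, map_sub, smul_sub, smul_sub, hf, hg]

lemma IsBarInvariant.sum {ι : Type*} {s : Finset ι} {n : ℕ} {f : ι → W →₀ ℤ[X]}
    (hf : ∀ i ∈ s, IsBarInvariant cs n (f i)) : IsBarInvariant cs n (∑ i ∈ s, f i) := by
  classical
  induction s using Finset.induction_on with
  | empty => exact IsBarInvariant.zero n
  | insert a s ha ih =>
    rw [Finset.sum_insert ha]
    exact (hf _ (Finset.mem_insert_self ..)).add (ih fun i hi => hf _ (Finset.mem_insert_of_mem hi))

/-- The factor `q ^ k` is absorbed by the change of normalization from `v ^ (-n)` to `v ^ (-(n +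
2k))`; an integer is its own bar conjugate. -/
lemma IsBarInvariant.smul {n : ℕ} {f : W →₀ ℤ[X]} (hf : IsBarInvariant cs n f) (a : ℤ) (k : ℕ) :
    IsBarInvariant cs (n + 2 * k) ((C a * X ^ k) • f) := by
  rw [IsBarInvariant] at *
  rw [barSum_smul, stdSum_smul]
  simp only [map_mul, aeval_C, map_pow, aeval_X, mul_smul]
  rw [smul_comm (vpow _) (algebraMap ℤ Coeff a), smul_comm (vpow _) (algebraMap ℤ Coeff a)]
  congr 1
  rw [qInv_pow, q_pow, smul_smul, smul_smul, ← vpow_add, ← vpow_add]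
  convert hf using 3 <;> push_cast <;> ring

lemma IsBarInvariant.single_one : IsBarInvariant cs 0 (Finsupp.single 1 1) := by
  simp [IsBarInvariant, barSum_single, stdSum_single, heckeTBar_one, heckeT_one]

variable (cs)

open Classical in
/-- Left multiplication by `T_s + 1`. -/
noncomputable def klOp (i : B) : (W →₀ ℤ[X]) →ₗ[ℤ[X]] (W →₀ ℤ[X]) :=
  Finsupp.linearCombination ℤ[X] fun x =>
    if cs.IsLeftDescent x i then
      (X : ℤ[X]) • (Finsupp.single x 1 + Finsupp.single (cs.simple i * x) 1)
    else Finsupp.single x 1 + Finsupp.single (cs.simple i * x) 1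

variable {cs}

lemma klOp_single {x : W} {i : B} (h : ¬ cs.IsLeftDescent x i) (p : ℤ[X]) :
    klOp cs i (Finsupp.single x p) = Finsupp.single x p + Finsupp.single (cs.simple i * x) p := by
  simp [klOp, h]

lemma klOp_single_of_isLeftDescent {x : W} {i : B} (h : cs.IsLeftDescent x i) (p : ℤ[X]) :
    klOp cs i (Finsupp.single x p) =
      Finsupp.single x (X * p) + Finsupp.single (cs.simple i * x) (X * p) := by
  simp [klOp, h, mul_comm]

lemma klOp_apply (f : W →₀ ℤ[X]) (i : B) (z : W) [Decidable (cs.IsLeftDescent z i)] :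
    klOp cs i f z = if cs.IsLeftDescent z i then f (cs.simple i * z) + X * f z
      else f z + X * f (cs.simple i * z) := by
  classical
  induction f using Finsupp.induction_linear with
  | zero => simp
  | add f g hf hg =>
    rw [map_add, Finsupp.add_apply, hf, hg]
    split_ifs <;> simp only [Finsupp.add_apply] <;> ring
  | single x a =>
    have hiff : x = cs.simple i * z ↔ cs.simple i * x = z := by
      constructor <;> rintro rfl <;> simp
    have hne : cs.simple i * x ≠ x := fun h => cs.length_simple_mul_ne x i (by rw [h])
    by_cases hx : cs.IsLeftDescent x i
    · rw [klOp_single_of_isLeftDescent hx]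
      by_cases hz : x = z
      · subst hz
        simp [hx, hne, hne.symm]
      · by_cases hz' : cs.simple i * x = z
        · have hz'' : ¬ cs.IsLeftDescent z i := by
            rw [← hz', isLeftDescent_simple_mul_iff, not_not]; exact hx
          simp [Finsupp.single_apply, hiff, hz, hz', hz'']
        · simp [hiff, hz, hz']
    · rw [klOp_single hx]
      by_cases hz : x = z
      · subst hz
        simp [hx, hne, hne.symm]
      · by_cases hz' : cs.simple i * x = z
        · have hz'' : cs.IsLeftDescent z i := by
            rw [← hz', isLeftDescent_simple_mul_iff]; exact hx
          simp [Finsupp.single_apply, hiff, hz, hz', hz'']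
        · simp [hiff, hz, hz']

lemma klOp_apply_simple_mul (f : W →₀ ℤ[X]) (i : B) (z : W) :
    klOp cs i f (cs.simple i * z) = klOp cs i f z := by
  classical
  rw [klOp_apply, klOp_apply, cs.simple_mul_simple_cancel_left, isLeftDescent_simple_mul_iff]
  split_ifs <;> rfl

lemma stdSum_klOp (i : B) (f : W →₀ ℤ[X]) :
    stdSum cs (klOp cs i f) = (heckeT cs (cs.simple i) + 1) * stdSum cs f := by
  induction f using Finsupp.induction_linear with
  | zero => simp
  | add f g hf hg => rw [map_add, map_add, hf, hg, map_add, mul_add]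
  | single x p =>
    by_cases hx : cs.IsLeftDescent x i
    · have h := heckeT_simple_mul (cs.isLeftDescent_iff_not_isLeftDescent_mul.1 hx)
      rw [cs.simple_mul_simple_cancel_left] at h
      rw [klOp_single_of_isLeftDescent hx, map_add, stdSum_single, stdSum_single, stdSum_single,
        mul_smul_comm, add_mul, one_mul, ← h, ← mul_assoc, heckeT_simple_sq, add_mul,
        smul_mul_assoc, smul_mul_assoc, one_mul, map_mul, aeval_X]
      module
    · rw [klOp_single hx, map_add, stdSum_single, stdSum_single, mul_smul_comm, add_mul, one_mul, heckeT_simple_mul hx, smul_add, add_comm]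

lemma barSum_klOp (i : B) (f : W →₀ ℤ[X]) :
    barSum cs (klOp cs i f) = (simpleInv cs i + 1) * barSum cs f := by
  induction f using Finsupp.induction_linear with
  | zero => simp
  | add f g hf hg => rw [map_add, map_add, hf, hg, map_add, mul_add]
  | single x p =>
    by_cases hx : cs.IsLeftDescent x i
    · have h := heckeTBar_simple_mul (cs.isLeftDescent_iff_not_isLeftDescent_mul.1 hx)
      rw [cs.simple_mul_simple_cancel_left] at h
      rw [klOp_single_of_isLeftDescent hx, map_add, barSum_single, barSum_single, barSum_single,
        mul_smul_comm, h, ← mul_assoc, simpleInv_add_one_mul, smul_mul_assoc, add_mul, one_mul,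
        map_mul, aeval_X]
      module
    · rw [klOp_single hx, map_add, barSum_single, barSum_single, mul_smul_comm, add_mul, one_mul, heckeTBar_simple_mul hx, smul_add, add_comm]

/-- The element `C'_s = v⁻¹ (T_s + 1)` is bar invariant, which accounts for the shift by 1. -/
lemma IsBarInvariant.klOp {n : ℕ} {f : W →₀ ℤ[X]} (hf : IsBarInvariant cs n f) (i : B) :
    IsBarInvariant cs (n + 1) (klOp cs i f) := by
  rw [IsBarInvariant] at *
  rw [barSum_klOp, stdSum_klOp]
  have h1 : vpow ((n + 1 : ℕ) : ℤ) = vpow (-1) * q * vpow n := by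
    rw [q, ← vpow_add, ← vpow_add]; congr 1; push_cast; ring
  have h2 : vpow (-((n + 1 : ℕ) : ℤ)) = vpow (-1) * vpow (-n) := by
    rw [← vpow_add]; congr 1; push_cast; ring
  rw [h1, h2, mul_smul, mul_smul, mul_smul, ← mul_smul_comm, ← mul_smul_comm (vpow (-n)), hf,
    ← smul_mul_assoc, q_smul_simpleInv_add_one]

/-- The degree bound for Kazhdan-Lusztig polynomials determines a bar invariant element from its
coefficient at `w`. -/
theorem IsBarInvariant.eq_zero [Fintype B] [DecidableEq B] [SimplyLaced M] {n : ℕ}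
    {f : W →₀ ℤ[X]} (hf : IsBarInvariant cs n f)
    (hd : ∀ x, f x ≠ 0 → 2 * (f x).natDegree + 1 + cs.length x ≤ n) : f = 0 := by
  by_contra hne
  -- At an `x` of maximal length in the support, triangularity leaves only the term of `x` on either
  -- side, so `f x` is self-dual and of too small a degree.
  obtain ⟨x, hx, hmax⟩ := f.support.exists_max_image cs.length (Finsupp.support_nonempty_iff.2 hne)
  have h := congrArg (fun h => coords cs h x) hf
  simp only [map_smul, Finsupp.smul_apply, smul_eq_mul, barSum_apply, stdSum_apply,
    Finsupp.sum, map_sum, Finsupp.finsetSum_apply] at h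
  rw [Finset.sum_eq_single_of_mem x hx, Finset.sum_eq_single_of_mem x hx] at h
  · rw [(coords_heckeTBar _ x rfl).1, coords_heckeT, Finsupp.single_eq_same, mul_one,
      ← mul_assoc] at h
    exact (Finsupp.mem_support_iff.1 hx)
      (eq_zero_of_selfDual (hd x (Finsupp.mem_support_iff.1 hx)) h)
  · intro y _ hy
    rw [coords_heckeT, Finsupp.single_eq_of_ne hy.symm, mul_zero]
  · intro y hy hyx
    rw [(coords_heckeTBar _ y rfl).2 x hyx.symm (hmax y hy), mul_zero]

theorem IsBarInvariant.ext [Fintype B] [DecidableEq B] [SimplyLaced M] {w : W}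
    {f g : W →₀ ℤ[X]} (hf : IsBarInvariant cs (cs.length w) f)
    (hg : IsBarInvariant cs (cs.length w) g) (hw : f w = g w)
    (hdf : ∀ x, x ≠ w → f x ≠ 0 → 2 * (f x).natDegree + 1 + cs.length x ≤ cs.length w)
    (hdg : ∀ x, x ≠ w → g x ≠ 0 → 2 * (g x).natDegree + 1 + cs.length x ≤ cs.length w) :
    f = g := by
  rw [← sub_eq_zero]
  refine (hf.sub hg).eq_zero fun x hx => ?_
  have hxw : x ≠ w := by
    rintro rfl
    rw [Finsupp.sub_apply, hw, sub_self] at hx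
    exact hx rfl
  rw [Finsupp.sub_apply] at hx ⊢
  have h1 := natDegree_sub_le (f x) (g x)
  by_cases hfx : f x = 0
  · have := hdg x hxw (by rintro h; simp [hfx, h] at hx)
    simpa [hfx] using this
  by_cases hgx : g x = 0
  · simpa [hgx] using hdf x hxw hfx
  have h2 := hdf x hxw hfx
  have h3 := hdg x hxw hgx
  omega

end BarInvariance

/-! ### Existence and uniqueness of Kazhdan–Lusztig polynomials -/

section Existence

variable {B W : Type*} [Group W] {M : CoxeterMatrix B} {cs : CoxeterSystem M W}

lemma isBarInvariant_iff {n : ℕ} {f : W →₀ ℤ[X]} : IsBarInvariant cs n f ↔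
    (f.sum fun x p => (vpow n * aeval qInv p) • Ring.inverse (heckeT cs x⁻¹)) =
      f.sum fun x p => (vpow (-n) * aeval q p) • heckeT cs x := by
  simp only [IsBarInvariant, barSum_apply, stdSum_apply, Finsupp.smul_sum, smul_smul, heckeTBar]

lemma IsKLFamily.isBarInvariant {w : W} {p : W →₀ ℤ[X]} (h : IsKLFamily cs w p) :
    IsBarInvariant cs (cs.length w) p :=
  isBarInvariant_iff.2 h.bar_invariant

lemma IsKLFamily.degree_le' {w : W} {p : W →₀ ℤ[X]} (h : IsKLFamily cs w p) {x : W}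
    (hxw : x ≠ w) (hx : p x ≠ 0) : 2 * (p x).natDegree + 1 + cs.length x ≤ cs.length w :=
  h.degree_le x (h.support_le x hx) hxw

lemma IsKLFamily.coeff_eq_zero {w : W} {p : W →₀ ℤ[X]} (h : IsKLFamily cs w p) {x : W}
    (hxw : x ≠ w) {k : ℕ} (hk : cs.length w < 2 * k + 1 + cs.length x) : (p x).coeff k = 0 := by
  by_cases hx : p x = 0
  · simp [hx]
  · have := h.degree_le' hxw hx
    exact coeff_eq_zero_of_natDegree_lt (by omega)

lemma IsKLFamily.eq_zero_of_length_lt {w : W} {p : W →₀ ℤ[X]} (h : IsKLFamily cs w p) {x : W}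
    (hx : cs.length w < cs.length x) : p x = 0 := by
  by_contra h'
  have := BruhatLE.length_le cs (h.support_le x h')
  omega

lemma isKLFamily_one : IsKLFamily cs 1 (Finsupp.single 1 1) := by
  refine ⟨by simp, fun x hx => ?_, fun x hx hne => ?_, ?_⟩
  · have : x = 1 := by
      by_contra h
      simp [Finsupp.single_eq_of_ne h] at hx
    rw [this]
    exact Relation.ReflTransGen.refl
  · have := BruhatLE.length_lt cs hx hne
    simp at this
  · rw [← isBarInvariant_iff, cs.length_one]
    exact IsBarInvariant.single_one

variable [Fintype B] [DecidableEq B] [SimplyLaced M]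

theorem IsKLFamily.unique {w : W} {p p' : W →₀ ℤ[X]} (h : IsKLFamily cs w p)
    (h' : IsKLFamily cs w p') : p = p' :=
  h.isBarInvariant.ext h'.isBarInvariant (by rw [h.apply_self, h'.apply_self])
    (fun _ => h.degree_le') (fun _ => h'.degree_le')

variable (cs) in
/-- The coefficient of `X ^ d` in `f z`, if `s_i z < z` and `n - ℓ(z) = 2 d + 1`. -/
noncomputable def klMu (i : B) (n : ℕ) (f : W →₀ ℤ[X]) (z : W) : ℤ :=
  open Classical in
  -- The equation forces `n > ℓ(z)` with odd difference, so the truncated subtraction does no harm.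
  if cs.IsLeftDescent z i ∧ n = cs.length z + 2 * ((n - cs.length z) / 2) + 1 then
    (f z).coeff ((n - cs.length z) / 2) else 0

/-- The recursion `C'_{su} = C'_s C'_u - ∑ μ(z,u) C'_z` over `z < u` with `sz < z`. Every term on
the right has coefficients that agree at `x` and `sx`, and so does the result. -/
lemma exists_isKLFamily_step {w : W} {i : B} (hi : cs.IsLeftDescent w i)
    (ih : ∀ z, cs.length z < cs.length w → ∃ p, IsKLFamily cs z p ∧
      ∀ j, cs.IsLeftDescent z j → ∀ x, p (cs.simple j * x) = p x) :
    ∃ p, IsKLFamily cs w p ∧ ∀ x, p (cs.simple i * x) = p x := by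
  classical
  obtain ⟨u, rfl⟩ : ∃ u, w = cs.simple i * u := ⟨cs.simple i * w, by simp⟩
  have hu : ¬ cs.IsLeftDescent u i := isLeftDescent_simple_mul_iff.1 hi
  have hlu := cs.not_isLeftDescent_iff.1 hu
  obtain ⟨f, hf, -⟩ := ih u (by omega)
  -- The value `0` chosen for the longer `z` is immaterial, as `μ z ≠ 0` forces `ℓ(z) < ℓ(u)`.
  have ih' : ∀ z, ∃ p, cs.length z < cs.length (cs.simple i * u) → IsKLFamily cs z p ∧
      ∀ j, cs.IsLeftDescent z j → ∀ x, p (cs.simple j * x) = p x := by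
    intro z
    by_cases hz : cs.length z < cs.length (cs.simple i * u)
    · obtain ⟨p, hp⟩ := ih z hz
      exact ⟨p, fun _ => hp⟩
    · exact ⟨0, fun h => absurd h hz⟩
  choose kl hkl using ih'
  set d : W → ℕ := fun z => (cs.length u - cs.length z) / 2 with hd
  set μ : W → ℤ := klMu cs i (cs.length u) f with hμ
  have hμ1 : ∀ z, μ z ≠ 0 → cs.IsLeftDescent z i ∧ cs.length u = cs.length z + 2 * d z + 1 ∧
      μ z = (f z).coeff (d z) := by
    intro z hz
    simp only [hμ, klMu] at hz ⊢
    split_ifs at hz ⊢ with h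
    · exact ⟨h.1, h.2, rfl⟩
    · exact absurd rfl hz
  have hμkl : ∀ z, μ z ≠ 0 → IsKLFamily cs z (kl z) ∧
      ∀ x, kl z (cs.simple i * x) = kl z x := by
    intro z hz
    obtain ⟨h1, h2, -⟩ := hμ1 z hz
    obtain ⟨h3, h4⟩ := hkl z (by omega)
    exact ⟨h3, h4 i h1⟩
  have hμsupp : ∀ z, μ z ≠ 0 → f z ≠ 0 := by
    intro z hz h
    rw [(hμ1 z hz).2.2, h, coeff_zero] at hz
    exact hz rfl
  set corr : W →₀ ℤ[X] := ∑ z ∈ f.support, (C (μ z) * X ^ (d z + 1)) • kl z with hcorr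
  have hcorr_apply : ∀ x, corr x = ∑ z ∈ f.support, (C (μ z) * X ^ (d z + 1)) * kl z x := by
    intro x
    simp [hcorr, Finsupp.finsetSum_apply]
  have huw := bruhatLE_simple_mul cs hu
  have hp_apply : ∀ x, (klOp cs i f - corr) x = klOp cs i f x - corr x := fun x =>
    Finsupp.sub_apply ..
  refine ⟨klOp cs i f - corr, ⟨?_, ?_, ?_, ?_⟩, ?_⟩
  · rw [hp_apply, klOp_apply, if_pos hi, cs.simple_mul_simple_cancel_left, hf.apply_self,
      hf.eq_zero_of_length_lt (by omega), mul_zero, add_zero, sub_eq_self, hcorr_apply]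
    refine Finset.sum_eq_zero fun z _ => ?_
    by_cases hz : μ z = 0
    · simp [hz]
    · have := (hμ1 z hz).2.1
      rw [(hμkl z hz).1.eq_zero_of_length_lt (by omega), mul_zero]
  · intro x hx
    rw [hp_apply] at hx
    by_cases h1 : corr x = 0
    · have h2 : f x ≠ 0 ∨ f (cs.simple i * x) ≠ 0 := by
        by_contra! h
        rw [klOp_apply, h.1, h.2, h1] at hx
        simp at hx
      rcases h2 with h2 | h2
      · exact (hf.support_le x h2).trans huw
      · have := BruhatLE.simple_mul cs (hf.support_le _ h2) hu
        rwa [cs.simple_mul_simple_cancel_left] at this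
    · rw [hcorr_apply] at h1
      obtain ⟨z, -, hz⟩ := Finset.exists_ne_zero_of_sum_ne_zero h1
      have hz1 : μ z ≠ 0 := by rintro h; simp [h] at hz
      exact (((hμkl z hz1).1.support_le x (right_ne_zero_of_mul hz)).trans
        (hf.support_le z (hμsupp z hz1))).trans huw
  · intro x hxw hne
    have hlt := BruhatLE.length_lt cs hxw hne
    suffices h : ((klOp cs i f - corr) x).natDegree ≤
        (cs.length (cs.simple i * u) - 1 - cs.length x) / 2 by omega
    rw [natDegree_le_iff_coeff_eq_zero]
    intro k hk
    have hk' : cs.length (cs.simple i * u) < 2 * k + 1 + cs.length x := by omega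
    -- Beyond the degree bound only `z = x` contributes: for `z ≠ x` the bound on `P_{x,z}` keeps `X
    -- ^ (d z + 1) P_{x,z}` below it.
    have hcorr_coeff : (corr x).coeff k = μ x * (X ^ (d x + 1) : ℤ[X]).coeff k := by
      rw [hcorr_apply, finsetSum_coeff, Finset.sum_eq_single x]
      · by_cases hx : μ x = 0
        · simp [hx]
        · rw [(hμkl x hx).1.apply_self, mul_one, coeff_C_mul]
      · intro z _ hzx
        by_cases hz : μ z = 0
        · simp [hz]
        · rw [mul_assoc, coeff_C_mul, coeff_X_pow_mul']
          split_ifs with hdk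
          · have := (hμ1 z hz).2.1
            rw [(hμkl z hz).1.coeff_eq_zero hzx.symm (by omega), mul_zero]
          · rw [mul_zero]
      · intro hx
        have : μ x = 0 := by
          by_contra h
          exact hx (Finsupp.mem_support_iff.2 (hμsupp x h))
        simp [this]
    rw [hp_apply, coeff_sub, hcorr_coeff, klOp_apply]
    have hX : ∀ (p : ℤ[X]), k ≠ 0 → (X * p).coeff k = p.coeff (k - 1) := by
      intro p h
      obtain ⟨m, rfl⟩ := Nat.exists_eq_succ_of_ne_zero h
      rw [Nat.succ_eq_add_one, coeff_X_mul, Nat.add_sub_cancel]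
    by_cases hx : cs.IsLeftDescent x i
    · have hlx := cs.isLeftDescent_iff.1 hx
      have hxu : x ≠ u := by rintro rfl; exact hu hx
      have hk0 : k ≠ 0 := by
        rintro rfl
        omega
      have hsx : cs.simple i * x ≠ u := by
        rintro rfl; exact hne (by simp)
      rw [if_pos hx, coeff_add, hf.coeff_eq_zero hsx (by omega), zero_add, hX _ hk0, coeff_X_pow]
      -- The term `X P_{x,u}` exceeds the bound at most in degree `d x + 1`, where its coefficient
      -- is `μ x` and cancels.
      by_cases hcase : cs.length u = cs.length x + 2 * d x + 1 ∧ k = d x + 1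
      · obtain ⟨hc1, hc2⟩ := hcase
        have : μ x = (f x).coeff (d x) := by
          simp only [hμ, klMu]
          exact if_pos ⟨hx, hc1⟩
        rw [if_pos hc2, mul_one, this, hc2, Nat.add_sub_cancel, sub_self]
      · have h1 : μ x * (if k = d x + 1 then 1 else 0) = 0 := by
          by_cases hx' : μ x = 0
          · simp [hx']
          · rw [if_neg, mul_zero]
            exact fun h => hcase ⟨(hμ1 x hx').2.1, h⟩
        have hdx : d x = (cs.length u - cs.length x) / 2 := rfl
        rw [h1, sub_zero]
        exact hf.coeff_eq_zero hxu (by omega)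
    · have hlx := cs.not_isLeftDescent_iff.1 hx
      have hμx : μ x = 0 := by
        by_contra h
        exact hx (hμ1 x h).1
      have hk0 : k ≠ 0 := by
        rintro rfl
        omega
      have hsx : cs.simple i * x ≠ u := by
        rintro rfl
        exact hu (isLeftDescent_simple_mul_iff.2 hx)
      rw [if_neg hx, hμx, zero_mul, sub_zero, coeff_add, hX _ hk0,
        hf.coeff_eq_zero hsx (by omega), add_zero]
      by_cases hxu : x = u
      · rw [hxu, hf.apply_self, coeff_one, if_neg hk0]
      · exact hf.coeff_eq_zero hxu (by omega)
  · rw [← isBarInvariant_iff]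
    refine IsBarInvariant.sub ?_ (IsBarInvariant.sum fun z _ => ?_)
    · rw [hlu]
      exact hf.isBarInvariant.klOp i
    · by_cases hz : μ z = 0
      · simpa [hz] using IsBarInvariant.zero _
      · have h1 := (hμ1 z hz).2.1
        have h2 : cs.length (cs.simple i * u) = cs.length z + 2 * (d z + 1) := by omega
        rw [h2]
        exact (hμkl z hz).1.isBarInvariant.smul _ _
  · intro x
    rw [hp_apply, hp_apply, klOp_apply_simple_mul, hcorr_apply, hcorr_apply]
    congr 1
    refine Finset.sum_congr rfl fun z _ => ?_
    by_cases hz : μ z = 0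
    · simp [hz]
    · rw [(hμkl z hz).2]

variable (cs) in
-- Each left descent yields its own construction, invariant under that reflection; by uniqueness
-- they all coincide, so the family is invariant under every left descent.
theorem exists_isKLFamily (w : W) : ∃ p, IsKLFamily cs w p ∧
    ∀ j, cs.IsLeftDescent w j → ∀ x, p (cs.simple j * x) = p x := by
  induction h : cs.length w using Nat.strong_induction_on generalizing w with
  | _ n ih =>
  by_cases hw : w = 1
  · subst hw
    exact ⟨_, isKLFamily_one, fun j hj => absurd hj (cs.not_isLeftDescent_one j)⟩
  · obtain ⟨i, hi⟩ := cs.exists_leftDescent_of_ne_one hw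
    have step := fun {i} (hi : cs.IsLeftDescent w i) =>
      exists_isKLFamily_step hi fun z hz => ih _ (h ▸ hz) z rfl
    obtain ⟨p, hp, -⟩ := step hi
    refine ⟨p, hp, fun j hj => ?_⟩
    obtain ⟨p', hp', h'⟩ := step hj
    rwa [hp.unique hp']

lemma klPoly_eq {w : W} {p : W →₀ ℤ[X]} (h : IsKLFamily cs w p) (x : W) :
    klPoly cs x w = p x := by
  have h' : IsKLFamily cs w (Classical.epsilon (IsKLFamily cs w)) :=
    Classical.epsilon_spec ⟨p, h⟩
  rw [klPoly, h'.unique h]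

/-- A bar invariant element subject to the degree bound has the Kazhdan-Lusztig polynomials as its
coefficients. -/
lemma klPoly_eq_of_isBarInvariant {w : W} {f : W →₀ ℤ[X]}
    (hf : IsBarInvariant cs (cs.length w) f) (hw : f w = 1)
    (hd : ∀ x, x ≠ w → f x ≠ 0 → 2 * (f x).natDegree + 1 + cs.length x ≤ cs.length w) (x : W) :
    klPoly cs x w = f x := by
  obtain ⟨p, hp, -⟩ := exists_isKLFamily cs w
  rw [klPoly_eq hp, hp.isBarInvariant.ext hf (by rw [hp.apply_self, hw])
    (fun _ => hp.degree_le') hd]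

/-- Invariance under the left descent `s` of `sx` gives `P_{x,sx} = P_{sx,sx} = 1`. -/
lemma klPrec_simple_mul {x : W} {i : B} (h : ¬ cs.IsLeftDescent x i) :
    KLPrec cs x (cs.simple i * x) := by
  obtain ⟨p, hp, hinv⟩ := exists_isKLFamily cs (cs.simple i * x)
  refine ⟨0, cs.not_isLeftDescent_iff.1 h, ?_⟩
  rw [klPoly_eq hp, ← hinv i (isLeftDescent_simple_mul_iff.2 h), hp.apply_self, degree_one]
  rfl

lemma klJoined_simple_mul (x : W) (i : B) : KLJoined cs x (cs.simple i * x) := by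
  by_cases h : cs.IsLeftDescent x i
  · have := klPrec_simple_mul (cs.isLeftDescent_iff_not_isLeftDescent_mul.1 h)
    rw [cs.simple_mul_simple_cancel_left] at this
    exact Or.inr this
  · exact Or.inl (klPrec_simple_mul h)

end Existence

/-! ### Weights: descents, cosets and the longest element of a parabolic subgroup -/

section Weights

variable {B W : Type*} [Fintype B] [DecidableEq B] [Group W] {M : CoxeterMatrix B}
  [SimplyLaced M] (cs : CoxeterSystem M W)

/-- The image of the weight `lam` under `z`, in terms of the fundamental weights. -/
noncomputable def weight (lam : B → ℤ) (z : W) (i : B) : ℤ :=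
  ∑ j, lam j * rootRep cs z⁻¹ (Pi.single i 1) j

lemma weight_one (lam : B → ℤ) : weight cs lam 1 = lam := by
  ext i
  simp [weight, Pi.single_apply]

lemma weight_simple_mul (lam : B → ℤ) (z : W) (i j : B) :
    weight cs lam (cs.simple i * z) j = weight cs lam z j - cartan M i j * weight cs lam z i := by
  simp only [weight, mul_inv_rev, cs.inv_simple, rootRep_mul_apply, rootRep_simple,
    simpleRefl_single, map_sub, map_smul, Pi.sub_apply, Pi.smul_apply, smul_eq_mul, mul_sub,
    Finset.sum_sub_distrib, Finset.mul_sum]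
  congr 1
  exact Finset.sum_congr rfl fun _ _ => by ring

variable {cs}

/-- The coordinate pairs `λ` with `z⁻¹ α_i`, a root that is negative exactly when `s_i` is a left
descent of `z`. -/
lemma weight_nonpos {lam : B → ℤ} (hlam : 0 ≤ lam) {z : W} {i : B} (h : cs.IsLeftDescent z i) :
    weight cs lam z i ≤ 0 := by
  rw [← cs.isRightDescent_inv_iff, ← rootRep_nonpos_iff] at h
  exact Finset.sum_nonpos fun j _ => mul_nonpos_of_nonneg_of_nonpos (hlam j) (h j)

lemma weight_nonneg {lam : B → ℤ} (hlam : 0 ≤ lam) {z : W} {i : B} (h : ¬ cs.IsLeftDescent z i) :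
    0 ≤ weight cs lam z i := by
  rw [← cs.isRightDescent_inv_iff, ← rootRep_nonneg_iff] at h
  exact Finset.sum_nonneg fun j _ => mul_nonneg (hlam j) (h j)

lemma isLeftDescent_of_weight_neg {lam : B → ℤ} (hlam : 0 ≤ lam) {z : W} {i : B}
    (h : weight cs lam z i < 0) : cs.IsLeftDescent z i := by
  by_contra h'
  exact absurd (weight_nonneg hlam h') (not_le.2 h)

lemma not_isLeftDescent_of_weight_pos {lam : B → ℤ} (hlam : 0 ≤ lam) {z : W} {i : B}
    (h : 0 < weight cs lam z i) : ¬ cs.IsLeftDescent z i := fun h' =>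
  absurd (weight_nonpos hlam h') (not_le.2 h)

lemma isLeftDescent_iff_weight_neg {lam : B → ℤ} (hlam : ∀ i, 0 < lam i) {z : W} {i : B} :
    cs.IsLeftDescent z i ↔ weight cs lam z i < 0 := by
  refine ⟨fun h => ?_, isLeftDescent_of_weight_neg fun i => (hlam i).le⟩
  rw [← cs.isRightDescent_inv_iff, ← rootRep_nonpos_iff] at h
  obtain ⟨j, hj⟩ := Function.ne_iff.1 (rootRep_single_ne_zero cs z⁻¹ i)
  exact Finset.sum_neg' (fun j _ => mul_nonpos_of_nonneg_of_nonpos (hlam j).le (h j))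
    ⟨j, Finset.mem_univ j, mul_neg_of_pos_of_neg (hlam j) (lt_of_le_of_ne (h j) hj)⟩

/-- A regular weight determines the left descents, so the same letter can be stripped from both
elements. -/
lemma weight_injective {lam : B → ℤ} (hlam : ∀ i, 0 < lam i) :
    Function.Injective (weight cs lam) := by
  intro x
  induction h : cs.length x generalizing x with
  | zero =>
    intro y hxy
    rw [cs.length_eq_zero_iff] at h
    subst h
    by_contra hy
    obtain ⟨i, hi⟩ := cs.exists_leftDescent_of_ne_one (Ne.symm hy)
    rw [isLeftDescent_iff_weight_neg hlam, ← hxy, ← isLeftDescent_iff_weight_neg hlam] at hi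
    exact cs.not_isLeftDescent_one i hi
  | succ n ih =>
    intro y hxy
    have hx : x ≠ 1 := by rintro rfl; simp at h
    obtain ⟨i, hi⟩ := cs.exists_leftDescent_of_ne_one hx
    have hi' := cs.isLeftDescent_iff.1 hi
    refine mul_left_cancel (ih (x := cs.simple i * x) (by omega) (a₂ := cs.simple i * y) ?_)
    ext j
    rw [weight_simple_mul, weight_simple_mul, hxy]

variable {lam : B → ℤ} {ω : List B}

lemma weight_wordProd_eq_self (hω : ∀ i ∈ ω, lam i = 0) :
    weight cs lam (cs.wordProd ω) = lam := by
  induction ω with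
  | nil => rw [cs.wordProd_nil, weight_one]
  | cons i ω ih =>
    have ih := ih fun j hj => hω j (List.mem_cons_of_mem _ hj)
    ext j
    rw [cs.wordProd_cons, weight_simple_mul, ih, hω i List.mem_cons_self, mul_zero, sub_zero]

/-- The Kazhdan-Lusztig polynomials of the longest element of a finite parabolic subgroup, which is
the stabilizer of a dominant weight. -/
lemma IsKLFamily.apply_eq_ite_weight (hlam : 0 ≤ lam) (hω : ∀ i ∈ ω, lam i = 0)
    (hdesc : ∀ i, lam i = 0 → cs.IsLeftDescent (cs.wordProd ω) i) {p : W →₀ ℤ[X]}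
    (hp : IsKLFamily cs (cs.wordProd ω) p)
    (hinv : ∀ j, cs.IsLeftDescent (cs.wordProd ω) j → ∀ x, p (cs.simple j * x) = p x) (z : W) :
    p z = open Classical in if weight cs lam z = lam then 1 else 0 := by
  have hone : p 1 = 1 := by
    rw [← hp.apply_self]
    clear hp
    have : ∀ ω' : List B, (∀ i ∈ ω', lam i = 0) → p 1 = p (cs.wordProd ω') := by
      intro ω' hω'
      induction ω' with
      | nil => rw [cs.wordProd_nil]
      | cons i ω' ih =>
        rw [cs.wordProd_cons, hinv i (hdesc i (hω' i List.mem_cons_self))]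
        exact ih fun j hj => hω' j (List.mem_cons_of_mem _ hj)
    exact this ω hω
  split_ifs with hz
  -- A left descent of an element fixing `λ` has coordinate zero in `λ`, hence is a descent of the
  -- longest element; removing it changes neither `p` nor the weight.
  · induction h : cs.length z generalizing z with
    | zero => rw [cs.length_eq_zero_iff.1 h, hone]
    | succ n ih =>
      have hz1 : z ≠ 1 := by rintro rfl; simp at h
      obtain ⟨i, hi⟩ := cs.exists_leftDescent_of_ne_one hz1
      have hi0 : lam i = 0 := le_antisymm (by
        have := weight_nonpos hlam hi
        rwa [hz] at this) (hlam i)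
      rw [← hinv i (hdesc i hi0)]
      refine ih _ ?_ ?_
      · ext j
        rw [weight_simple_mul, hz, hi0, mul_zero, sub_zero]
      · have := cs.isLeftDescent_iff.1 hi
        omega
  · by_contra hpz
    obtain ⟨ω', hω', rfl⟩ := BruhatLE.exists_sublist cs (hp.support_le z hpz)
    exact hz (weight_wordProd_eq_self fun i hi => hω i (hω'.subset hi))

end Weights

/-! ### Single steps of the left preorder -/

section LeftPreorder

variable {B W : Type*} [Group W] {M : CoxeterMatrix B} {cs : CoxeterSystem M W}

lemma leftLE_simple_mul [Fintype B] [DecidableEq B] [SimplyLaced M] {x : W} {i j : B} (h₁ : cs.IsLeftDescent x j)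
    (h₂ : ¬ cs.IsLeftDescent (cs.simple i * x) j) : LeftLE cs x (cs.simple i * x) :=
  Relation.ReflTransGen.single ⟨klJoined_simple_mul x i, fun h => h₂ (h h₁)⟩

lemma leftLE_of_klPrec {x y : W} {j : B} (h : KLPrec cs x y) (h₁ : cs.IsLeftDescent x j)
    (h₂ : ¬ cs.IsLeftDescent y j) : LeftLE cs x y :=
  Relation.ReflTransGen.single ⟨Or.inl h, fun h => h₂ (h h₁)⟩

end LeftPreorder

/-! ### Type `E₈`: deciding descents and equalities through `ρ` -/

section TypeE8

instance : SimplyLaced CoxeterMatrix.E₈ where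
  eq_two_or_three i j := by fin_cases i <;> fin_cases j <;> simp [CoxeterMatrix.E₈]

/-- The rows of the Cartan matrix of type `E₈`. -/
def cartanRow : Fin 8 → List ℤ :=
  ![[2, 0, -1, 0, 0, 0, 0, 0], [0, 2, 0, -1, 0, 0, 0, 0], [-1, 0, 2, -1, 0, 0, 0, 0],
    [0, -1, -1, 2, -1, 0, 0, 0], [0, 0, 0, -1, 2, -1, 0, 0], [0, 0, 0, 0, -1, 2, -1, 0],
    [0, 0, 0, 0, 0, -1, 2, -1], [0, 0, 0, 0, 0, 0, -1, 2]]

lemma cartanRow_eq (i : Fin 8) : cartanRow i = List.ofFn (cartan CoxeterMatrix.E₈ i) := by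
  revert i
  decide +kernel

/-- The simple reflection `i` on weights, given as lists of coordinates. -/
def reflect (i : Fin 8) (v : List ℤ) : List ℤ :=
  List.zipWith (fun a c => a - c * v.getD i 0) v (cartanRow i)

/-- The dominant weight whose stabilizer is generated by the simple reflections other than
`s₄` and `s₇`. -/
def lamE8 : List ℤ := [0, 0, 0, 1, 0, 0, 1, 0]

/-- The sum of the fundamental weights. -/
def rhoE8 : List ℤ := [1, 1, 1, 1, 1, 1, 1, 1]

variable {W : Type*} [Group W] (cs : CoxeterSystem CoxeterMatrix.E₈ W)

/-- The image of a weight under `z`, as a list of coordinates. -/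
noncomputable def weightList (lam : List ℤ) (z : W) : List ℤ :=
  List.ofFn (weight cs (fun i => lam.getD i 0) z)

variable {cs}

lemma weightList_getD (lam : List ℤ) (z : W) (i : Fin 8) :
    (weightList cs lam z).getD i 0 = weight cs (fun i => lam.getD i 0) z i := by
  rw [weightList, List.getD_eq_getElem _ _ (by simp), List.getElem_ofFn]

lemma weightList_simple_mul (lam : List ℤ) (z : W) (i : Fin 8) :
    weightList cs lam (cs.simple i * z) = reflect i (weightList cs lam z) := by
  rw [reflect, cartanRow_eq, weightList_getD]
  apply List.ext_getElem
  · simp [weightList, -List.ofFn_succ]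
  · intro n h₁ h₂
    simp only [weightList, List.getElem_ofFn, List.getElem_zipWith, weight_simple_mul]

lemma weightList_one {lam : List ℤ} (h : lam.length = 8) : weightList cs lam 1 = lam := by
  rw [weightList, weight_one]
  apply List.ext_getElem
  · simp [h]
  · intro n h₁ h₂
    rw [List.getElem_ofFn, List.getD_eq_getElem]

lemma weightList_wordProd {lam : List ℤ} (h : lam.length = 8) (ω : List (Fin 8)) :
    weightList cs lam (cs.wordProd ω) = ω.foldr reflect lam := by
  induction ω with
  | nil => rw [cs.wordProd_nil, weightList_one h, List.foldr_nil]
  | cons i ω ih => rw [cs.wordProd_cons, weightList_simple_mul, ih, List.foldr_cons]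

lemma rhoE8_pos (i : Fin 8) : 0 < rhoE8.getD i 0 := by revert i; decide

lemma isLeftDescent_wordProd_iff {ω : List (Fin 8)} {i : Fin 8} :
    cs.IsLeftDescent (cs.wordProd ω) i ↔ (ω.foldr reflect rhoE8).getD i 0 < 0 := by
  rw [isLeftDescent_iff_weight_neg rhoE8_pos, ← weightList_getD, weightList_wordProd rfl]

lemma wordProd_eq_of_foldr_eq {ω ω' : List (Fin 8)}
    (h : ω.foldr reflect rhoE8 = ω'.foldr reflect rhoE8) : cs.wordProd ω = cs.wordProd ω' := by
  rw [← weightList_wordProd (cs := cs) rfl, ← weightList_wordProd (cs := cs) rfl] at h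
  exact weight_injective rhoE8_pos (List.ofFn_injective h)

/-- No letter of the word is a left descent of the product of the letters that follow. -/
def ReducedWord : List (Fin 8) → Prop
  | [] => True
  | i :: ω => 0 ≤ (ω.foldr reflect rhoE8).getD i 0 ∧ ReducedWord ω

instance instDecidableReducedWord : (ω : List (Fin 8)) → Decidable (ReducedWord ω)
  | [] => isTrue trivial
  | _ :: ω =>
    have := instDecidableReducedWord ω
    inferInstanceAs (Decidable (_ ∧ _))

lemma ReducedWord.length_eq {ω : List (Fin 8)} (h : ReducedWord ω) :
    cs.length (cs.wordProd ω) = ω.length := by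
  induction ω with
  | nil => simp
  | cons i ω ih =>
    rw [cs.wordProd_cons, List.length_cons, ← ih h.2, ← cs.not_isLeftDescent_iff,
      isLeftDescent_wordProd_iff, not_lt]
    exact h.1

/-- Each step of multiplying the product of `ω` on the left by the letters of a list, in turn,
loses a left descent. -/
def LosesDescents : List (Fin 8) → List (Fin 8) → Prop
  | [], _ => True
  | i :: l, ω => (∃ j : Fin 8, (ω.foldr reflect rhoE8).getD j 0 < 0 ∧
      ¬ ((i :: ω).foldr reflect rhoE8).getD j 0 < 0) ∧ LosesDescents l (i :: ω)

instance instDecidableLosesDescents :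
    (l ω : List (Fin 8)) → Decidable (LosesDescents l ω)
  | [], _ => isTrue trivial
  | i :: l, ω =>
    have := instDecidableLosesDescents l (i :: ω)
    inferInstanceAs (Decidable (_ ∧ _))

/-- The elements `x` and `s x` are joined whichever is longer, so losing a descent is all there is
to check. The word is reversed because letters are prefixed in turn. -/
lemma LosesDescents.leftLE {l ω : List (Fin 8)} (h : LosesDescents l ω) :
    LeftLE cs (cs.wordProd ω) (cs.wordProd (l.reverse ++ ω)) := by
  induction l generalizing ω with
  | nil => exact Relation.ReflTransGen.refl
  | cons i l ih =>
    obtain ⟨⟨j, h₁, h₂⟩, h₃⟩ := h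
    have h₄ := ih h₃
    rw [List.reverse_cons, List.append_assoc, List.singleton_append]
    refine Relation.ReflTransGen.trans ?_ h₄
    rw [cs.wordProd_cons]
    refine leftLE_simple_mul (isLeftDescent_wordProd_iff.2 h₁) ?_
    rwa [← cs.wordProd_cons, isLeftDescent_wordProd_iff]

end TypeE8

/-! ### Coset-constant elements as lists of pairs -/

section Certificates

variable {W : Type*} [Group W] {cs : CoxeterSystem CoxeterMatrix.E₈ W}

open Classical in
variable (cs) in
/-- The function on `W` whose value at `z` is the sum of the `X ^ k` over the pairs `(v, k)` in the
list for which `z` maps the weight `lamE8` to `v`. -/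
noncomputable def listPoly (L : List (List ℤ × ℕ)) (z : W) : ℤ[X] :=
  (L.map fun e => if weightList cs lamE8 z = e.1 then (X : ℤ[X]) ^ e.2 else 0).sum

lemma listPoly_nil (z : W) : listPoly cs [] z = 0 := rfl

open Classical in
lemma listPoly_cons (e : List ℤ × ℕ) (L : List (List ℤ × ℕ)) (z : W) :
    listPoly cs (e :: L) z =
      (if weightList cs lamE8 z = e.1 then (X : ℤ[X]) ^ e.2 else 0) + listPoly cs L z := by
  simp [listPoly]

lemma listPoly_append (L L' : List (List ℤ × ℕ)) (z : W) :
    listPoly cs (L ++ L') z = listPoly cs L z + listPoly cs L' z := by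
  simp [listPoly]

lemma listPoly_perm {L L' : List (List ℤ × ℕ)} (h : L.Perm L') (z : W) :
    listPoly cs L z = listPoly cs L' z :=
  (h.map _).sum_eq

/-- The effect of multiplication by `T_s + 1` on a single pair. -/
def stepPair (i : Fin 8) (e : List ℤ × ℕ) : List (List ℤ × ℕ) :=
  if e.1.getD i 0 < 0 then [(e.1, e.2 + 1), (reflect i e.1, e.2 + 1)]
  else if 0 < e.1.getD i 0 then [e, (reflect i e.1, e.2)]
  else [e, (e.1, e.2 + 1)]

/-- The effect of multiplication by `T_s + 1` on a list of pairs. -/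
def stepList (i : Fin 8) (L : List (List ℤ × ℕ)) : List (List ℤ × ℕ) := L.flatMap (stepPair i)

/-- Multiplication of a list of pairs by `X ^ k`. -/
def shiftList (k : ℕ) (L : List (List ℤ × ℕ)) : List (List ℤ × ℕ) :=
  L.map fun e => (e.1, e.2 + k)

lemma listPoly_shiftList (k : ℕ) (L : List (List ℤ × ℕ)) (z : W) :
    listPoly cs (shiftList k L) z = X ^ k * listPoly cs L z := by
  induction L with
  | nil => simp [shiftList, listPoly_nil]
  | cons e L ih =>
    rw [shiftList, List.map_cons, listPoly_cons, listPoly_cons, mul_add, ← ih, shiftList]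
    congr 1
    split_ifs
    · rw [pow_add, mul_comm]
    · rw [mul_zero]

lemma lamE8_nonneg : (0 : Fin 8 → ℤ) ≤ fun i : Fin 8 => lamE8.getD i 0 := by
  have : ∀ i : Fin 8, 0 ≤ lamE8.getD i 0 := by decide
  exact this

lemma cartanRow_length (i : Fin 8) : (cartanRow i).length = 8 := by revert i; decide

lemma reflect_length {v : List ℤ} (hv : v.length = 8) (i : Fin 8) : (reflect i v).length = 8 := by
  simp [reflect, hv, cartanRow_length]

lemma exists_eq_of_length_eq_eight {v : List ℤ} (hv : v.length = 8) :
    ∃ a b c d e f g h, v = [a, b, c, d, e, f, g, h] := by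
  match v, hv with
  | [a, b, c, d, e, f, g, h], _ => exact ⟨a, b, c, d, e, f, g, h, rfl⟩

lemma reflect_getD_self {v : List ℤ} (hv : v.length = 8) (i : Fin 8) :
    (reflect i v).getD i 0 = - v.getD i 0 := by
  obtain ⟨a, b, c, d, e, f, g, h, rfl⟩ := exists_eq_of_length_eq_eight hv
  fin_cases i <;> simp [reflect, cartanRow] <;> ring

lemma reflect_reflect {v : List ℤ} (hv : v.length = 8) (i : Fin 8) :
    reflect i (reflect i v) = v := by
  obtain ⟨a, b, c, d, e, f, g, h, rfl⟩ := exists_eq_of_length_eq_eight hv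
  fin_cases i <;> simp [reflect, cartanRow] <;> omega

lemma reflect_of_getD_eq_zero {v : List ℤ} (hv : v.length = 8) {i : Fin 8}
    (h0 : v.getD i 0 = 0) : reflect i v = v := by
  apply List.ext_getElem
  · rw [reflect_length hv, hv]
  · intro n h₁ h₂
    simp [reflect, -List.getD_eq_getElem?_getD, h0]

lemma weightList_length (lam : List ℤ) (z : W) : (weightList cs lam z).length = 8 := by
  simp [weightList, -List.ofFn_succ]

open Classical in
-- A pair stands for `q ^ k` times a coset sum. If `s` moves the coset, `T_s + 1` spreads the sum
-- over both cosets, with an extra factor `q` when it starts from the upper one; if `s` preserves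
-- the coset, it multiplies the sum by `1 + q`.
lemma listPoly_stepPair (i : Fin 8) {e : List ℤ × ℕ} (he : e.1.length = 8) (z : W) :
    listPoly cs (stepPair i e) z = if cs.IsLeftDescent z i then
      listPoly cs [e] (cs.simple i * z) + X * listPoly cs [e] z
      else listPoly cs [e] z + X * listPoly cs [e] (cs.simple i * z) := by
  obtain ⟨v, k⟩ := e
  have hdn : (weightList cs lamE8 z).getD i 0 < 0 → cs.IsLeftDescent z i := fun h =>
    isLeftDescent_of_weight_neg lamE8_nonneg (by rwa [weightList_getD] at h)
  have hdp : 0 < (weightList cs lamE8 z).getD i 0 → ¬ cs.IsLeftDescent z i := fun h =>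
    not_isLeftDescent_of_weight_pos lamE8_nonneg (by rwa [weightList_getD] at h)
  have hu := weightList_length (cs := cs) lamE8 z
  simp only [stepPair]
  rcases lt_trichotomy (v.getD i 0) 0 with h | h | h
  · rw [if_pos h]
    simp only [listPoly_cons, listPoly_nil, add_zero, weightList_simple_mul]
    generalize weightList cs lamE8 z = u at *
    have hrr := reflect_reflect hu i
    have hneg := reflect_getD_self hu i
    by_cases huv : u = v
    · subst huv
      have h1 : reflect i u ≠ u := fun h' => by rw [h'] at hneg; omega
      rw [if_pos (hdn h), if_neg h1, if_neg h1.symm, if_pos rfl, if_pos rfl, pow_succ']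
      ring
    · by_cases huv' : reflect i u = v
      · subst huv'
        rw [if_neg huv, if_neg huv, hrr, if_pos rfl, if_pos rfl, if_neg (hdp (by omega)), pow_succ']
      · have h1 : u ≠ reflect i v := fun h' => huv' (by rw [h', reflect_reflect he])
        simp [huv, huv', h1]
  · rw [if_neg (by omega), if_neg (by omega)]
    simp only [listPoly_cons, listPoly_nil, add_zero, weightList_simple_mul]
    generalize weightList cs lamE8 z = u at *
    by_cases huv : u = v
    · subst huv
      rw [reflect_of_getD_eq_zero hu h, if_pos rfl, if_pos rfl, pow_succ']
      simp
    · have h1 : reflect i u ≠ v := fun h' => huv (by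
        rw [← reflect_reflect hu i, h', reflect_of_getD_eq_zero he h])
      simp [huv, h1]
  · rw [if_neg (by omega), if_pos h]
    simp only [listPoly_cons, listPoly_nil, add_zero, weightList_simple_mul]
    generalize weightList cs lamE8 z = u at *
    have hrr := reflect_reflect hu i
    have hneg := reflect_getD_self hu i
    by_cases huv : u = v
    · subst huv
      have h1 : reflect i u ≠ u := fun h' => by rw [h'] at hneg; omega
      rw [if_neg (hdp h), if_neg h1, if_neg h1.symm, if_pos rfl]
      ring
    · by_cases huv' : reflect i u = v
      · subst huv'
        rw [if_neg huv, hrr, if_pos rfl, if_pos rfl, if_pos (hdn (by omega))]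
        ring
      · have h1 : u ≠ reflect i v := fun h' => huv' (by rw [h', reflect_reflect he])
        simp [huv, huv', h1]

open Classical in
lemma listPoly_stepList (i : Fin 8) {L : List (List ℤ × ℕ)} (hL : ∀ e ∈ L, e.1.length = 8) (z : W) :
    listPoly cs (stepList i L) z = if cs.IsLeftDescent z i then
      listPoly cs L (cs.simple i * z) + X * listPoly cs L z
      else listPoly cs L z + X * listPoly cs L (cs.simple i * z) := by
  induction L with
  | nil => simp [stepList, listPoly_nil]
  | cons e L ih =>
    have ih := ih fun e' h => hL e' (List.mem_cons_of_mem _ h)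
    have h1 : ∀ x : W, listPoly cs (e :: L) x = listPoly cs [e] x + listPoly cs L x := fun x => by
      rw [← listPoly_append, List.singleton_append]
    rw [stepList, List.flatMap_cons, listPoly_append, ← stepList, ih,
      listPoly_stepPair i (hL e List.mem_cons_self), h1, h1]
    split_ifs <;> ring

variable (cs) in
/-- The function given by the list extends to a bar invariant element of degree `n`. -/
def IsBarInvariantList (n : ℕ) (L : List (List ℤ × ℕ)) : Prop :=
  (∀ e ∈ L, e.1.length = 8) ∧ ∃ f, IsBarInvariant cs n f ∧ ∀ z, f z = listPoly cs L z

lemma IsBarInvariantList.step {n : ℕ} {L : List (List ℤ × ℕ)} (h : IsBarInvariantList cs n L)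
    (i : Fin 8) : IsBarInvariantList cs (n + 1) (stepList i L) := by
  classical
  obtain ⟨hL, f, hf, hfL⟩ := h
  refine ⟨?_, klOp cs i f, hf.klOp i, fun z => ?_⟩
  · intro e he
    obtain ⟨e', he', h⟩ := List.mem_flatMap.1 he
    have h1 := hL e' he'
    have h2 := reflect_length h1 i
    simp only [stepPair] at h
    split_ifs at h <;> simp only [List.mem_cons, List.not_mem_nil, or_false] at h <;>
      rcases h with rfl | rfl <;> assumption
  · rw [klOp_apply, listPoly_stepList i hL]
    simp only [hfL]

/-- `List.diff` ignores entries that are absent, so it is a true subtraction only under `hsub`. -/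
lemma IsBarInvariantList.diff {n m k : ℕ} {L L' : List (List ℤ × ℕ)}
    (h : IsBarInvariantList cs n L) (h' : IsBarInvariantList cs m L') (hn : n = m + 2 * k)
    (hsub : (shiftList k L').Subperm L) :
    IsBarInvariantList cs n (L.diff (shiftList k L')) := by
  obtain ⟨hL, f, hf, hfL⟩ := h
  obtain ⟨-, f', hf', hfL'⟩ := h'
  subst hn
  refine ⟨fun e he => hL e (List.diff_subset _ _ he), f - (C 1 * X ^ k) • f',
    hf.sub (hf'.smul 1 k), fun z => ?_⟩
  have h1 := listPoly_perm (cs := cs) (List.subperm_append_diff_self_of_count_le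
    (List.subperm_ext_iff.1 hsub)) z
  rw [listPoly_append, listPoly_shiftList] at h1
  simp only [Finsupp.sub_apply, Finsupp.smul_apply, smul_eq_mul, hfL, hfL', ← h1, C_1, one_mul]
  ring

end Certificates

/-! ### From lists to Kazhdan–Lusztig polynomials -/

section Verification

variable {W : Type*} [Group W] {cs : CoxeterSystem CoxeterMatrix.E₈ W}

/-- A reduced word for the longest element of the stabilizer of `lamE8`. -/
def stabWord : List (Fin 8) := [0, 2, 0, 1, 4, 5, 4, 7]

lemma stabWord_length : cs.length (cs.wordProd stabWord) = 8 :=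
  ReducedWord.length_eq (ω := stabWord) (by decide +kernel)

lemma isKLFamily_stabWord_apply {p : W →₀ ℤ[X]} (hp : IsKLFamily cs (cs.wordProd stabWord) p)
    (hinv : ∀ j, cs.IsLeftDescent (cs.wordProd stabWord) j → ∀ x, p (cs.simple j * x) = p x)
    (z : W) : p z = listPoly cs [(lamE8, 0)] z := by
  have h1 : ∀ i ∈ stabWord, lamE8.getD i 0 = 0 := by decide
  have h2 : ∀ i : Fin 8, lamE8.getD i 0 = 0 →
      (stabWord.foldr reflect rhoE8).getD i 0 < 0 := by decide +kernel
  rw [hp.apply_eq_ite_weight lamE8_nonneg h1 (fun i hi => isLeftDescent_wordProd_iff.2 (h2 i hi))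
    hinv, listPoly_cons, listPoly_nil, pow_zero, add_zero]
  have h3 : weightList cs lamE8 z = lamE8 ↔
      weight cs (fun i : Fin 8 => lamE8.getD i 0) z = fun i : Fin 8 => lamE8.getD i 0 := by
    have : lamE8 = List.ofFn fun i : Fin 8 => lamE8.getD i 0 := by decide
    conv_lhs => rhs; rw [this]
    rw [weightList, List.ofFn_injective.eq_iff]
  simp only [h3]

lemma isBarInvariantList_lamE8 : IsBarInvariantList cs 8 [(lamE8, 0)] := by
  obtain ⟨p, hp, hinv⟩ := exists_isKLFamily cs (cs.wordProd stabWord)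
  refine ⟨by decide, p, ?_, isKLFamily_stabWord_apply hp hinv⟩
  have := hp.isBarInvariant
  rwa [stabWord_length] at this

lemma length_le_of_weightList_eq_lamE8 {x : W} (h : weightList cs lamE8 x = lamE8) :
    cs.length x ≤ 8 ∧ (cs.length x = 8 → x = cs.wordProd stabWord) := by
  obtain ⟨p, hp, hinv⟩ := exists_isKLFamily cs (cs.wordProd stabWord)
  have h1 : p x ≠ 0 := by
    rw [isKLFamily_stabWord_apply hp hinv, listPoly_cons, if_pos h, listPoly_nil]
    simp
  have h2 := hp.support_le x h1
  have h3 := stabWord_length (cs := cs)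
  refine ⟨(BruhatLE.length_le cs h2).trans h3.le, fun h4 => ?_⟩
  by_contra hne
  have := BruhatLE.length_lt cs h2 hne
  omega

/-- The number of simple reflections, each at a negative coordinate, that take a weight to `lamE8`,
if it is at most the given bound. -/
def weightDepth : ℕ → List ℤ → Option ℕ
  | 0, v => if v = lamE8 then some 0 else none
  | n + 1, v =>
    if v = lamE8 then some 0
    else ((List.finRange 8).find? fun i : Fin 8 => decide (v.getD i 0 < 0)).bind fun i =>
      (weightDepth n (reflect i v)).map (· + 1)

/-- A negative coordinate is a left descent of every element of the coset, so all of them shorten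
together until they lie in the stabilizer of `λ`, whose unique longest element has length 8. -/
lemma length_le_of_weightDepth {n d : ℕ} {v : List ℤ} (hd : weightDepth n v = some d) {x : W}
    (hx : weightList cs lamE8 x = v) : cs.length x ≤ d + 8 ∧
      ∀ y, weightList cs lamE8 y = v → cs.length x = d + 8 → cs.length y = d + 8 → x = y := by
  have base : ∀ {v}, v = lamE8 → ∀ {x : W}, weightList cs lamE8 x = v → cs.length x ≤ 0 + 8 ∧
      ∀ y, weightList cs lamE8 y = v → cs.length x = 0 + 8 → cs.length y = 0 + 8 → x = y := by
    rintro v rfl x hx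
    refine ⟨(length_le_of_weightList_eq_lamE8 hx).1, fun y hy h1 h2 => ?_⟩
    rw [(length_le_of_weightList_eq_lamE8 hx).2 h1, (length_le_of_weightList_eq_lamE8 hy).2 h2]
  induction n generalizing v d x with
  | zero =>
    rw [weightDepth] at hd
    split_ifs at hd with h
    obtain rfl := Option.some_injective _ hd
    exact base h hx
  | succ n ih =>
    rw [weightDepth] at hd
    split_ifs at hd with h
    · obtain rfl := Option.some_injective _ hd
      exact base h hx
    · obtain ⟨i, hi, hd⟩ := Option.bind_eq_some_iff.1 hd
      obtain ⟨d', hd', rfl⟩ := Option.map_eq_some_iff.1 hd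
      have hneg : v.getD i 0 < 0 := by simpa using List.find?_some hi
      have key : ∀ {x : W}, weightList cs lamE8 x = v →
          cs.length (cs.simple i * x) + 1 = cs.length x ∧
          weightList cs lamE8 (cs.simple i * x) = reflect i v := by
        intro x hx
        refine ⟨cs.isLeftDescent_iff.1 (isLeftDescent_of_weight_neg lamE8_nonneg ?_), ?_⟩
        · rwa [← weightList_getD, hx]
        · rw [weightList_simple_mul, hx]
      obtain ⟨h1, h2⟩ := key hx
      obtain ⟨h3, h4⟩ := ih hd' h2
      refine ⟨by omega, fun y hy h5 h6 => ?_⟩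
      obtain ⟨h7, h8⟩ := key hy
      exact mul_left_cancel (h4 _ h8 (by omega) (by omega))

lemma listPoly_eq_sum_filter (L : List (List ℤ × ℕ)) {z : W} {v : List ℤ}
    (hz : weightList cs lamE8 z = v) : listPoly cs L z =
      (((L.filter fun e => decide (e.1 = v)).map Prod.snd).map fun k => (X : ℤ[X]) ^ k).sum := by
  induction L with
  | nil => rfl
  | cons e L ih =>
    rw [listPoly_cons, ih, List.filter_cons, hz]
    by_cases h : e.1 = v
    · simp [h]
    · simp [h, Ne.symm h]

/-- The degree bound for Kazhdan-Lusztig polynomials, for a pair with a weight other than `v`. -/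
def DegreeBound (n : ℕ) (v : List ℤ) (e : List ℤ × ℕ) : Prop :=
  e.1 = v ∨ ((weightDepth n e.1).any fun d => decide (2 * e.2 + 1 + (d + 8) ≤ n)) = true

instance (n : ℕ) (v : List ℤ) : DecidablePred (DegreeBound n v) := fun _ =>
  inferInstanceAs (Decidable (_ ∨ _))

lemma natDegree_listPoly_le {n : ℕ} {v : List ℤ} {L : List (List ℤ × ℕ)}
    (hdeg : ∀ e ∈ L, DegreeBound n v e) {z : W} (hz : weightList cs lamE8 z ≠ v)
    (hne : listPoly cs L z ≠ 0) :
    2 * (listPoly cs L z).natDegree + 1 + cs.length z ≤ n := by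
  have h1 : ∀ e ∈ L, weightList cs lamE8 z = e.1 → 2 * e.2 + 1 + cs.length z ≤ n := by
    intro e he h
    rcases hdeg e he with h' | h'
    · exact absurd (h.trans h') hz
    · cases hd : weightDepth n e.1 with
      | none => simp [hd] at h'
      | some d =>
        rw [hd, Option.any_some] at h'
        have h1 := of_decide_eq_true h'
        have h2 := (length_le_of_weightDepth hd h).1
        omega
  -- This keeps `n - 1 - ℓ(z)` below from being truncated.
  have h2 : cs.length z + 1 ≤ n := by
    by_contra hlt
    refine hne ?_
    rw [listPoly_eq_sum_filter L rfl, List.filter_eq_nil_iff.2]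
    · rfl
    · intro e he h
      have := h1 e he (of_decide_eq_true h).symm
      omega
  suffices h : (listPoly cs L z).natDegree ≤ (n - 1 - cs.length z) / 2 by omega
  clear hne hdeg
  induction L with
  | nil => simp [listPoly_nil]
  | cons e L ih =>
    rw [listPoly_cons]
    refine natDegree_add_le_of_degree_le ?_ (ih fun e' h => h1 e' (List.mem_cons_of_mem _ h))
    split_ifs with h
    · rw [natDegree_X_pow]
      have := h1 e List.mem_cons_self h
      omega
    · simp

/-- A list that satisfies the degree bound describes a family of Kazhdan-Lusztig polynomials. -/
lemma IsBarInvariantList.klPoly_eq {n : ℕ} {v : List ℤ} {L : List (List ℤ × ℕ)}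
    (h : IsBarInvariantList cs n L) {w : W} (hw : weightList cs lamE8 w = v)
    (hn : cs.length w = n) (hv : (weightDepth n v).map (· + 8) = some n)
    (htop : L.filter (fun e => decide (e.1 = v)) = [(v, 0)])
    (hdeg : ∀ e ∈ L, DegreeBound n v e) (x : W) : klPoly cs x w = listPoly cs L x := by
  obtain ⟨-, f, hf, hfL⟩ := h
  subst hn
  obtain ⟨d, hd, hd'⟩ := Option.map_eq_some_iff.1 hv
  have hone : ∀ z, weightList cs lamE8 z = v → f z = 1 := by
    intro z hz
    rw [hfL, listPoly_eq_sum_filter L hz, htop]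
    simp
  rw [← hfL]
  refine klPoly_eq_of_isBarInvariant hf (hone w hw) (fun z hzw hz => ?_) x
  -- `DegreeBound` exempts the coset of `w` itself: there `f` is 1 and the bound reads `ℓ(z) <
  -- ℓ(w)`, true because `w` is the unique longest element of its coset.
  by_cases hzv : weightList cs lamE8 z = v
  · rw [hone z hzv, natDegree_one]
    obtain ⟨h1, h2⟩ := length_le_of_weightDepth hd hzv
    by_contra hlt
    exact hzw (h2 w hw (by omega) (by omega))
  · rw [hfL] at hz ⊢
    exact natDegree_listPoly_le hdeg hzv hz

end Verification

/-! ### The two nontrivial edges and the chain -/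

section Certificates

/-- The pairs `(v, k)` for `C_{s₄ w}`, where `w` is the longest element of the stabilizer. -/
def pairs4 : List (List ℤ × ℕ) := stepList 3 [(lamE8, 0)]

/-- The pairs for `C_{s₅ s₄ w}`; the digits in the following names are to be read likewise. -/
def pairs54 : List (List ℤ × ℕ) := (stepList 4 pairs4).diff (shiftList 1 [(lamE8, 0)])

def pairs654 : List (List ℤ × ℕ) := (stepList 5 pairs54).diff (shiftList 1 pairs4)

def pairs23654 : List (List ℤ × ℕ) := stepList 1 (stepList 2 pairs654)

def pairs34 : List (List ℤ × ℕ) := (stepList 2 pairs4).diff (shiftList 1 [(lamE8, 0)])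

def pairs24 : List (List ℤ × ℕ) := (stepList 1 pairs4).diff (shiftList 1 [(lamE8, 0)])

def pairs4234 : List (List ℤ × ℕ) :=
  ((stepList 3 (stepList 1 pairs34)).diff (shiftList 1 pairs24)).diff (shiftList 1 pairs34)

def pairs54234 : List (List ℤ × ℕ) := stepList 4 pairs4234

def pairs454234 : List (List ℤ × ℕ) := (stepList 3 pairs54234).diff (shiftList 1 pairs4234)

def pairs2454234 : List (List ℤ × ℕ) := (stepList 1 pairs454234).diff (shiftList 1 pairs54234)

variable {W : Type*} [Group W] {cs : CoxeterSystem CoxeterMatrix.E₈ W}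

/-- For the intermediate lists bar invariance suffices; the degree bound is checked only for
`pairs23654` and `pairs2454234`. -/
lemma isBarInvariantList_pairs4 : IsBarInvariantList cs 9 pairs4 :=
  isBarInvariantList_lamE8.step 3

lemma isBarInvariantList_pairs54 : IsBarInvariantList cs 10 pairs54 :=
  (isBarInvariantList_pairs4.step 4).diff isBarInvariantList_lamE8 rfl (by decide +kernel)

lemma isBarInvariantList_pairs654 : IsBarInvariantList cs 11 pairs654 :=
  (isBarInvariantList_pairs54.step 5).diff isBarInvariantList_pairs4 rfl (by decide +kernel)

lemma isBarInvariantList_pairs23654 : IsBarInvariantList cs 13 pairs23654 :=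
  (isBarInvariantList_pairs654.step 2).step 1

lemma isBarInvariantList_pairs34 : IsBarInvariantList cs 10 pairs34 :=
  (isBarInvariantList_pairs4.step 2).diff isBarInvariantList_lamE8 rfl (by decide +kernel)

lemma isBarInvariantList_pairs24 : IsBarInvariantList cs 10 pairs24 :=
  (isBarInvariantList_pairs4.step 1).diff isBarInvariantList_lamE8 rfl (by decide +kernel)

lemma isBarInvariantList_pairs4234 : IsBarInvariantList cs 12 pairs4234 :=
  (((isBarInvariantList_pairs34.step 1).step 3).diff isBarInvariantList_pairs24 rfl
    (by decide +kernel)).diff isBarInvariantList_pairs34 rfl (by decide +kernel)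

lemma isBarInvariantList_pairs54234 : IsBarInvariantList cs 13 pairs54234 :=
  isBarInvariantList_pairs4234.step 4

lemma isBarInvariantList_pairs454234 : IsBarInvariantList cs 14 pairs454234 :=
  (isBarInvariantList_pairs54234.step 3).diff isBarInvariantList_pairs4234 rfl (by decide +kernel)

lemma isBarInvariantList_pairs2454234 : IsBarInvariantList cs 15 pairs2454234 :=
  (isBarInvariantList_pairs454234.step 1).diff isBarInvariantList_pairs54234 rfl
    (by decide +kernel)

variable (cs)

/-- The polynomial is `1 + 2 X + X ^ 2`, and the lengths are `8` and `13`. -/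
lemma klPrec_pairs23654 :
    KLPrec cs (cs.wordProd stabWord) (cs.wordProd ([1, 2, 5, 4, 3] ++ stabWord)) := by
  have hlen : cs.length (cs.wordProd ([1, 2, 5, 4, 3] ++ stabWord)) = 13 :=
    ReducedWord.length_eq (by decide +kernel)
  refine ⟨2, by rw [stabWord_length, hlen], ?_⟩
  rw [isBarInvariantList_pairs23654.klPoly_eq (weightList_wordProd rfl _) hlen
    (by decide +kernel) (by decide +kernel) (by decide +kernel),
    listPoly_eq_sum_filter _ (weightList_wordProd rfl _),
    show (pairs23654.filter _).map Prod.snd = [0, 1, 1, 2] by decide +kernel]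
  simp only [List.map_cons, List.map_nil, List.sum_cons, List.sum_nil]
  compute_degree!

/-- The polynomial is `1 + X`, and the lengths are `12` and `15`. -/
lemma klPrec_pairs2454234 :
    KLPrec cs (cs.wordProd ([3, 1, 4, 3] ++ stabWord))
      (cs.wordProd ([1, 3, 4, 3, 1, 2, 3] ++ stabWord)) := by
  have hlen : cs.length (cs.wordProd ([1, 3, 4, 3, 1, 2, 3] ++ stabWord)) = 15 :=
    ReducedWord.length_eq (by decide +kernel)
  have hlen' : cs.length (cs.wordProd ([3, 1, 4, 3] ++ stabWord)) = 12 :=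
    ReducedWord.length_eq (by decide +kernel)
  refine ⟨1, by rw [hlen', hlen], ?_⟩
  rw [isBarInvariantList_pairs2454234.klPoly_eq (weightList_wordProd rfl _) hlen
    (by decide +kernel) (by decide +kernel) (by decide +kernel),
    listPoly_eq_sum_filter _ (weightList_wordProd rfl _),
    show (pairs2454234.filter _).map Prod.snd = [0, 1] by decide +kernel]
  simp only [List.map_cons, List.map_nil, List.sum_cons, List.sum_nil]
  compute_degree!

lemma leftLE_stabWord_right :
    LeftLE cs (cs.wordProd ([1, 2, 4, 3, 1, 2, 4, 3, 6] ++ stabWord)) (cs.wordProd stabWord) := by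
  have h := LosesDescents.leftLE (cs := cs) (l := [1, 2, 4, 3, 1, 2, 4, 3, 6])
    (ω := [1, 2, 4, 3, 1, 2, 4, 3, 6] ++ stabWord) (by decide +kernel)
  rwa [wordProd_eq_of_foldr_eq (ω := List.reverse _ ++ _) (ω' := stabWord)
    (by decide +kernel)] at h

lemma leftLE_stabWord_left :
    LeftLE cs (cs.wordProd stabWord) (cs.wordProd ([1, 2, 4, 3, 1, 2, 4, 3, 6] ++ stabWord)) := by
  have h1 := leftLE_of_klPrec (klPrec_pairs23654 cs) (j := 0)
    (isLeftDescent_wordProd_iff.2 (by decide +kernel))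
    (mt isLeftDescent_wordProd_iff.1 (by decide +kernel))
  -- This uses `s₆s₄s₃ · s₂s₃s₆s₅s₄ = s₄s₂s₅s₄`.
  have h2 := LosesDescents.leftLE (cs := cs) (l := [2, 3, 5])
    (ω := [1, 2, 5, 4, 3] ++ stabWord) (by decide +kernel)
  rw [wordProd_eq_of_foldr_eq (ω := List.reverse _ ++ _) (ω' := [3, 1, 4, 3] ++ stabWord)
    (by decide +kernel)] at h2
  have h3 := leftLE_of_klPrec (klPrec_pairs2454234 cs) (j := 0)
    (isLeftDescent_wordProd_iff.2 (by decide +kernel))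
    (mt isLeftDescent_wordProd_iff.1 (by decide +kernel))
  -- Since `s₇` commutes with `s₂, s₃, s₄, s₅` and `s₄s₅s₄ = s₅s₄s₅`, the product `s₃s₇ ·
  -- s₂s₄s₅s₄s₂s₃s₄` equals `w₁`.
  have h4 := LosesDescents.leftLE (cs := cs) (l := [6, 2])
    (ω := [1, 3, 4, 3, 1, 2, 3] ++ stabWord) (by decide +kernel)
  rw [wordProd_eq_of_foldr_eq (ω := List.reverse _ ++ _)
    (ω' := [1, 2, 4, 3, 1, 2, 4, 3, 6] ++ stabWord)
    (by decide +kernel)] at h4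
  exact ((h1.trans h2).trans h3).trans h4

end Certificates

end KazhdanLusztig

/-- Mathlib numbers the simple reflections of type `E₈` as Bourbaki does, but starting from `0`. -/
theorem proposition3p1 {W : Type*} [Group W] (cs : CoxeterSystem CoxeterMatrix.E₈ W) :
    let s₁ := cs.simple 0
    let s₂ := cs.simple 1
    let s₃ := cs.simple 2
    let s₄ := cs.simple 3
    let s₅ := cs.simple 4
    let s₆ := cs.simple 5
    let s₇ := cs.simple 6
    let s₈ := cs.simple 7
    let w₁ := (s₂ * s₃ * s₅ * s₄) ^ 2 * s₇
    let w₂ := s₁ * s₃ * s₁ * s₂ * s₅ * s₆ * s₅ * s₈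
    KazhdanLusztig.LeftCellEquiv cs (w₁ * w₂) w₂ := by
  intro s₁ s₂ s₃ s₄ s₅ s₆ s₇ s₈ w₁ w₂
  have h₂ : w₂ = cs.wordProd KazhdanLusztig.stabWord := by
    simp [w₂, s₁, s₂, s₃, s₅, s₆, s₈, KazhdanLusztig.stabWord, cs.wordProd_cons, mul_assoc]
  have h₁ : w₁ * w₂ =
      cs.wordProd ([1, 2, 4, 3, 1, 2, 4, 3, 6] ++ KazhdanLusztig.stabWord) := by
    rw [cs.wordProd_append, ← h₂]
    simp [w₁, s₂, s₃, s₄, s₅, s₇, cs.wordProd_cons, pow_two, mul_assoc]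
  rw [h₁, h₂]
  exact ⟨KazhdanLusztig.leftLE_stabWord_right cs, KazhdanLusztig.leftLE_stabWord_left cs⟩
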